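/- A tanglegram $(T,S,\phi)$ of size $n\ge 1$ consists of two rooted binary trees $T,S$ with $n$ leaves each (every vertex has zero or two children, the children being unordered) and a bijection $\phi$ from the leaves of $T$ to the leaves of $S$; tanglegrams are considered up to isomorphism (tree isomorphisms $T\cong T'$, $S\cong S'$ compatible with $\phi,\phi'$). A layout lists the leaves of $T$ and the leaves of $S$ from top to bottom in planar embeddings of the two trees; a crossing is a pair of leaves of $T$ whose order is opposite to that of the leaves matched with them; and $(T,S,\phi)$ is planar if some layout has no crossing. A leaf-matched pair is a pair $(u,v)$ of internal (that is, non-leaf) vertices $u\in T$, $v\in S$ such that $\phi$ maps the set of leaves descending from $u$ onto the set of leaves descending from $v$. A tanglegram is irreducible if it has size at least $2$ and the pair of roots is its only leaf-matched pair. Define the formal power series $$F(x,q)=\sum_{(T,S,\phi)\text{ planar}} x^{\mathrm{size}(T,S,\phi)}\,q^{|\{\text{leaf-matched pairs of }(T,S,\phi)\}|},$$ and $$H(x)=\sum_{(T,S,\phi)\text{ irreducible planar}} x^{\mathrm{size}(T,S,\phi)},$$ except that the coefficient of $x^2$ in $H$ is by convention taken to be $\frac12$. Then $$F(x,q)=x+q\cdot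 H(F(x,q))+\frac{q\cdot F(x^2,q^2)}{2}.$$ -/

import Mathlib

/-- Rooted binary trees with leaves labelled by `α`: every vertex has zero or two children. The
order of the two children is only a choice of planar embedding; it is forgotten by `BinTree.Iso`. -/
inductive BinTree (α : Type) : Type
  | leaf (a : α) : BinTree α
  | node (l r : BinTree α) : BinTree α

namespace BinTree

/-- The labels of the leaves, from first to last in the embedding. -/
def leaves {α : Type} : BinTree α → List α
  | leaf a => [a]
  | node l r => l.leaves ++ r.leaves

/-- Relabelling of the leaves. -/
def map {α β : Type} (f : α → β) : BinTree α → BinTree β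
  | leaf a => leaf (f a)
  | node l r => node (l.map f) (r.map f)

/-- The vertices of a tree, each one represented by the subtree rooted at it. (If the leaves of the
tree have distinct labels, then distinct vertices have distinct subtrees.) -/
def vertices {α : Type} : BinTree α → Set (BinTree α)
  | leaf a => {leaf a}
  | node l r => insert (node l r) (l.vertices ∪ r.vertices)

/-- The vertex (represented by its subtree) has children. -/
def IsInternal {α : Type} (u : BinTree α) : Prop := ∃ l r, u = node l r

/-- The set of labels of the leaves that descend from a vertex. -/
def leafSet {α : Type} (u : BinTree α) : Set α := {a | a ∈ u.leaves}

/-- Label-preserving isomorphism of rooted trees: the children of any vertices may be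
interchanged. -/
inductive Iso {α : Type} : BinTree α → BinTree α → Prop
  | leaf (a : α) : Iso (leaf a) (leaf a)
  | node {l l' r r' : BinTree α} : Iso l l' → Iso r r' → Iso (node l r) (node l' r')
  | swap {l l' r r' : BinTree α} : Iso l l' → Iso r r' → Iso (node l r) (node r' l')

theorem Iso.rfl' {α : Type} (t : BinTree α) : Iso t t := by
  induction t with
  | leaf a => exact Iso.leaf a
  | node l r hl hr => exact Iso.node hl hr

theorem Iso.symm {α : Type} {s t : BinTree α} (h : Iso s t) : Iso t s := by
  induction h with
  | leaf a => exact Iso.leaf a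
  | node _ _ h1 h2 => exact Iso.node h1 h2
  | swap _ _ h1 h2 => exact Iso.swap h2 h1

theorem Iso.trans {α : Type} {s t u : BinTree α} (h : Iso s t) (h' : Iso t u) : Iso s u := by
  induction h generalizing u with
  | leaf a => exact h'
  | node _ _ h1 h2 =>
    cases h' with
    | node g1 g2 => exact Iso.node (h1 g1) (h2 g2)
    | swap g1 g2 => exact Iso.swap (h1 g1) (h2 g2)
  | swap _ _ h1 h2 =>
    cases h' with
    | node g1 g2 => exact Iso.swap (h1 g2) (h2 g1)
    | swap g1 g2 => exact Iso.node (h1 g2) (h2 g1)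

theorem Iso.map {α β : Type} (f : α → β) {s t : BinTree α} (h : Iso s t) :
    Iso (s.map f) (t.map f) := by
  induction h with
  | leaf a => exact Iso.leaf _
  | node _ _ h1 h2 => exact Iso.node h1 h2
  | swap _ _ h1 h2 => exact Iso.swap h1 h2

theorem map_map {α β γ : Type} (f : α → β) (g : β → γ) (t : BinTree α) :
    (t.map f).map g = t.map (fun a => g (f a)) := by
  induction t with
  | leaf a => rfl
  | node l r hl hr => simp only [BinTree.map, hl, hr]

theorem map_id' {α : Type} (t : BinTree α) : t.map (fun a => a) = t := by
  induction t with
  | leaf a => rfl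
  | node l r hl hr => simp only [BinTree.map, hl, hr]

end BinTree

/-- A tanglegram of size `n`: rooted binary trees `T`, `S`, the leaves of each labelled bijectively
by `Fin n`, and a bijection `φ` that matches leaf `i` of `T` with leaf `φ i` of `S`. -/
structure Tanglegram (n : ℕ) where
  T : BinTree (Fin n)
  S : BinTree (Fin n)
  φ : Equiv.Perm (Fin n)
  nodup_T : T.leaves.Nodup
  mem_T : ∀ i, i ∈ T.leaves
  nodup_S : S.leaves.Nodup
  mem_S : ∀ i, i ∈ S.leaves

namespace Tanglegram

/-- Isomorphism of tanglegrams: the leaves of both trees are relabelled compatibly with the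
matchings, and the relabelled trees are isomorphic to the given ones. -/
def Iso {n : ℕ} (t t' : Tanglegram n) : Prop :=
  ∃ σ τ : Equiv.Perm (Fin n),
    (t.T.map σ).Iso t'.T ∧ (t.S.map τ).Iso t'.S ∧ ∀ i, t'.φ (σ i) = τ (t.φ i)

theorem Iso.rfl' {n : ℕ} (t : Tanglegram n) : t.Iso t := by
  refine ⟨Equiv.refl _, Equiv.refl _, ?_, ?_, fun _ => rfl⟩
  · have h : t.T.map (fun a => a) = t.T := BinTree.map_id' t.T
    exact h.symm ▸ BinTree.Iso.rfl' t.T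
  · have h : t.S.map (fun a => a) = t.S := BinTree.map_id' t.S
    exact h.symm ▸ BinTree.Iso.rfl' t.S

theorem Iso.symm {n : ℕ} {t t' : Tanglegram n} (h : t.Iso t') : t'.Iso t := by
  obtain ⟨σ, τ, hT, hS, hφ⟩ := h
  refine ⟨σ⁻¹, τ⁻¹, ?_, ?_, fun i => ?_⟩
  · have h := (hT.map (σ⁻¹ : Equiv.Perm (Fin n))).symm
    rw [BinTree.map_map] at h
    simpa [BinTree.map_id'] using h
  · have h := (hS.map (τ⁻¹ : Equiv.Perm (Fin n))).symm
    rw [BinTree.map_map] at h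
    simpa [BinTree.map_id'] using h
  · have h := hφ (σ⁻¹ i)
    simp only [Equiv.Perm.inv_def, Equiv.apply_symm_apply] at h ⊢
    rw [h, Equiv.symm_apply_apply]

theorem Iso.trans {n : ℕ} {t t' t'' : Tanglegram n} (h : t.Iso t') (h' : t'.Iso t'') :
    t.Iso t'' := by
  obtain ⟨σ, τ, hT, hS, hφ⟩ := h
  obtain ⟨σ', τ', hT', hS', hφ'⟩ := h'
  refine ⟨σ' * σ, τ' * τ, ?_, ?_, fun i => ?_⟩
  · have h := (hT.map σ').trans hT'
    rwa [BinTree.map_map] at h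
  · have h := (hS.map τ').trans hS'
    rwa [BinTree.map_map] at h
  · rw [Equiv.Perm.mul_apply, Equiv.Perm.mul_apply, hφ', hφ]

/-- Tanglegrams are considered up to isomorphism. -/
def isoSetoid (n : ℕ) : Setoid (Tanglegram n) where
  r := Iso
  iseqv := ⟨Iso.rfl', Iso.symm, Iso.trans⟩

/-- A layout is a pair of lists: the leaves of `T` and those of `S`, each from top to bottom in
some planar embedding of the tree. -/
def IsLayout {n : ℕ} (t : Tanglegram n) (X Y : List (Fin n)) : Prop :=
  (∃ T', t.T.Iso T' ∧ T'.leaves = X) ∧ (∃ S', t.S.Iso S' ∧ S'.leaves = Y)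

/-- The number of crossings of a layout: leaf `i` of `T` is above leaf `j` of `T`, but the leaf
matched with `i` is below the leaf matched with `j`. -/
def crossings {n : ℕ} (t : Tanglegram n) (X Y : List (Fin n)) : ℕ :=
  (Finset.univ.filter fun p : Fin n × Fin n =>
    X.idxOf p.1 < X.idxOf p.2 ∧ Y.idxOf (t.φ p.2) < Y.idxOf (t.φ p.1)).card

/-- The least number of crossings over all layouts. -/
noncomputable def crossingNumber {n : ℕ} (t : Tanglegram n) : ℕ :=
  sInf {c | ∃ X Y, t.IsLayout X Y ∧ t.crossings X Y = c}

/-- A tanglegram is planar if its crossing number is zero. -/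
def IsPlanar {n : ℕ} (t : Tanglegram n) : Prop := t.crossingNumber = 0

/-- Pairs of internal vertices `u` of `T`, `v` of `S` whose descendant leaves are matched with each
other by `φ`. -/
def leafMatchedPairs {n : ℕ} (t : Tanglegram n) : Set (BinTree (Fin n) × BinTree (Fin n)) :=
  {p | p.1 ∈ t.T.vertices ∧ p.1.IsInternal ∧ p.2 ∈ t.S.vertices ∧ p.2.IsInternal ∧
    t.φ '' p.1.leafSet = p.2.leafSet}

/-- The pair of roots is a leaf-matched pair (so that the size is at least two) and there is no
other. -/
def IsIrreducible {n : ℕ} (t : Tanglegram n) : Prop := t.leafMatchedPairs = {(t.T, t.S)}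

/-- The number of tanglegrams of size `n`, up to isomorphism, with a given (isomorphism-invariant)
property. -/
noncomputable def count (n : ℕ) (P : Tanglegram n → Prop) : ℕ :=
  Set.ncard {c : Quotient (isoSetoid n) | ∃ t, P t ∧ Quotient.mk (isoSetoid n) t = c}

/-- The generating function `F(x,q)`, where `x = X 0` and `q = X 1`: the coefficient of `x^n q^k` is
the number of planar tanglegrams of size `n` with exactly `k` leaf-matched pairs. -/
noncomputable def F : MvPowerSeries (Fin 2) ℚ :=
  fun m => (count (m 0) fun t => t.IsPlanar ∧ t.leafMatchedPairs.ncard = m 1 : ℚ)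

/-- The generating function `H(x)`: the coefficient of `x^n` is the number of irreducible planar
tanglegrams of size `n`, except that by convention the coefficient of `x^2` is `1/2`. -/
noncomputable def H : PowerSeries ℚ :=
  PowerSeries.mk fun n =>
    if n = 2 then (1 / 2 : ℚ) else (count n fun t => t.IsPlanar ∧ t.IsIrreducible : ℚ)

end Tanglegram

/-! Give matched leaves the same label. A leaf-matched pair then becomes a common cluster: a set
that is the leaf set of an internal vertex in both trees. In a planar tanglegram of size at least
two, contract the maximal common clusters other than the whole leaf set. What remains is an
irreducible planar skeleton with k ≥ 2 leaves, and each of its leaves carries a planar tanglegram.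
Conversely every such grafting is planar, its size is the sum of the sizes of the pieces, and its
leaf-matched pairs are those of the pieces together with the pair of roots. Since isomorphisms
preserve common clusters, the skeleton and the pieces are unique up to isomorphism (`exists_graft`,
`IsGraft.clusters_inter`, `IsGraft.exists_iso`).

It remains to see when different assignments of pieces to the leaves of one skeleton give isomorphic
results, which is a question about its automorphisms. A planar layout of an irreducible pair is
unique up to reflection (`leaves_eq_or_eq_reverse`), so an automorphism fixes or reverses the order
of the leaves. A reversal would exchange the children of both roots. Both roots would then split the
leaves in the middle, and for k ≥ 3 the two first children would form a second leaf-matched pair.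
Hence skeletons with k ≥ 3 leaves are rigid (`eq_of_automorphism`), and each contributes q F^k.

For k = 2 the only skeleton is the cherry, whose leaves can be exchanged. The pieces form an
unordered pair, with series (F(x,q)^2 + F(x^2,q^2))/2. The first summand is what the conventional
coefficient 1/2 in H produces, and the second is the correction term. Size one gives x. The
bijection is `PlanarClass.decompositionEquiv`; the lemmas on `weightGenFun` turn it into power
series. -/

namespace BinTree

/-! ### Leaves and clusters under relabelling, grafting and isomorphism. -/

variable {α β γ : Type}

/-- Grafting: every leaf `a` is replaced by the tree `f a`. -/
def bind (f : α → BinTree β) : BinTree α → BinTree β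
  | leaf a => f a
  | node l r => node (l.bind f) (r.bind f)

/-- The leaf sets of the internal vertices. -/
def clusters : BinTree α → Set (Set α)
  | leaf _ => ∅
  | node l r => insert (node l r).leafSet (l.clusters ∪ r.clusters)

/-- The mirror image of a planar embedding. -/
def mirror : BinTree α → BinTree α
  | leaf a => leaf a
  | node l r => node r.mirror l.mirror

@[simp] theorem leaves_leaf (a : α) : (leaf a).leaves = [a] := rfl

@[simp] theorem leaves_node (l r : BinTree α) : (node l r).leaves = l.leaves ++ r.leaves := rfl

theorem leaves_map (f : α → β) (t : BinTree α) : (t.map f).leaves = t.leaves.map f := by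
  induction t with
  | leaf a => rfl
  | node l r hl hr => simp [BinTree.map, hl, hr]

theorem leaves_bind (f : α → BinTree β) (t : BinTree α) :
    (t.bind f).leaves = t.leaves.flatMap fun a => (f a).leaves := by
  induction t with
  | leaf a => simp [bind]
  | node l r hl hr => simp [bind, hl, hr]

theorem leaves_mirror (t : BinTree α) : t.mirror.leaves = t.leaves.reverse := by
  induction t with
  | leaf a => rfl
  | node l r hl hr => simp [mirror, hl, hr]

theorem leaves_ne_nil (t : BinTree α) : t.leaves ≠ [] := by
  induction t with
  | leaf a => simp
  | node l r hl hr => simp [hl]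

theorem leaves_length_pos (t : BinTree α) : 0 < t.leaves.length :=
  List.length_pos_of_ne_nil t.leaves_ne_nil

theorem mem_leafSet {t : BinTree α} {a : α} : a ∈ t.leafSet ↔ a ∈ t.leaves := Iff.rfl

theorem leafSet_nonempty (t : BinTree α) : t.leafSet.Nonempty :=
  List.exists_mem_of_ne_nil _ t.leaves_ne_nil

@[simp] theorem leafSet_leaf (a : α) : (leaf a).leafSet = {a} := by
  ext; simp [leafSet]

@[simp] theorem leafSet_node (l r : BinTree α) : (node l r).leafSet = l.leafSet ∪ r.leafSet := by
  ext; simp [leafSet]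

theorem leafSet_map (f : α → β) (t : BinTree α) : (t.map f).leafSet = f '' t.leafSet := by
  ext; simp [leafSet, leaves_map]

theorem leafSet_bind (f : α → BinTree β) (t : BinTree α) :
    (t.bind f).leafSet = ⋃ a ∈ t.leafSet, (f a).leafSet := by
  ext; simp [leafSet, leaves_bind]

theorem bind_map (f : α → β) (g : β → BinTree γ) (t : BinTree α) :
    (t.map f).bind g = t.bind fun a => g (f a) := by
  induction t with
  | leaf a => rfl
  | node l r hl hr => simp [BinTree.map, bind, hl, hr]

theorem map_bind (f : α → BinTree β) (g : β → γ) (t : BinTree α) :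
    (t.bind f).map g = t.bind fun a => (f a).map g := by
  induction t with
  | leaf a => rfl
  | node l r hl hr => simp [BinTree.map, bind, hl, hr]

theorem map_congr {f g : α → β} {t : BinTree α} (h : ∀ a ∈ t.leafSet, f a = g a) :
    t.map f = t.map g := by
  induction t with
  | leaf a => simp [BinTree.map, h a]
  | node l r hl hr =>
    simp only [leafSet_node, Set.mem_union] at h
    simp [BinTree.map, hl fun a ha => h a (Or.inl ha), hr fun a ha => h a (Or.inr ha)]

theorem map_eq_self {f : α → α} {t : BinTree α} (h : ∀ a ∈ t.leafSet, f a = a) :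
    t.map f = t := (map_congr h).trans (map_id' t)

theorem iso_mirror (t : BinTree α) : t.Iso t.mirror := by
  induction t with
  | leaf a => exact Iso.leaf a
  | node l r hl hr => exact Iso.swap hl hr

theorem Iso.leaves_perm {s t : BinTree α} (h : s.Iso t) : s.leaves.Perm t.leaves := by
  induction h with
  | leaf a => exact List.Perm.refl _
  | node _ _ h1 h2 => exact h1.append h2
  | swap _ _ h1 h2 => exact (h1.append h2).trans List.perm_append_comm

theorem Iso.leafSet_eq {s t : BinTree α} (h : s.Iso t) : s.leafSet = t.leafSet :=
  Set.ext fun _ => h.leaves_perm.mem_iff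

theorem Iso.clusters_eq {s t : BinTree α} (h : s.Iso t) : s.clusters = t.clusters := by
  induction h with
  | leaf a => rfl
  | node h h' h1 h2 => simp only [clusters, leafSet_node, h1, h2, h.leafSet_eq, h'.leafSet_eq]
  | swap h h' h1 h2 =>
    simp only [clusters, leafSet_node, h1, h2, h.leafSet_eq, h'.leafSet_eq, Set.union_comm]

theorem Iso.bind_left {s t : BinTree α} (h : s.Iso t) (f : α → BinTree β) :
    (s.bind f).Iso (t.bind f) := by
  induction h with
  | leaf a => exact Iso.rfl' _
  | node _ _ h1 h2 => exact Iso.node h1 h2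
  | swap _ _ h1 h2 => exact Iso.swap h1 h2

theorem iso_bind_right {f g : α → BinTree β} {t : BinTree α}
    (h : ∀ a ∈ t.leafSet, (f a).Iso (g a)) : (t.bind f).Iso (t.bind g) := by
  induction t with
  | leaf a => exact h a (by simp)
  | node l r hl hr =>
    simp only [leafSet_node, Set.mem_union] at h
    exact Iso.node (hl fun a ha => h a (Or.inl ha)) (hr fun a ha => h a (Or.inr ha))

theorem clusters_finite (t : BinTree α) : t.clusters.Finite := by
  induction t with
  | leaf a => exact Set.finite_empty
  | node l r hl hr => exact (hl.union hr).insert _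

theorem subset_of_mem_clusters {t : BinTree α} {A : Set α} (h : A ∈ t.clusters) :
    A ⊆ t.leafSet := by
  induction t with
  | leaf a => exact h.elim
  | node l r hl hr =>
    rcases h with rfl | h | h
    · exact subset_rfl
    · rw [leafSet_node]; exact (hl h).trans Set.subset_union_left
    · rw [leafSet_node]; exact (hr h).trans Set.subset_union_right

theorem nodup_node {l r : BinTree α} (h : (node l r).leaves.Nodup) :
    l.leaves.Nodup ∧ r.leaves.Nodup ∧ Disjoint l.leafSet r.leafSet := by
  rw [leaves_node, List.nodup_append'] at h
  exact ⟨h.1, h.2.1, Set.disjoint_left.2 fun a ha hb => h.2.2 ha hb⟩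

theorem nontrivial_of_mem_clusters {t : BinTree α} (ht : t.leaves.Nodup) {A : Set α}
    (h : A ∈ t.clusters) : A.Nontrivial := by
  induction t with
  | leaf a => exact h.elim
  | node l r hl hr =>
    obtain ⟨h1, h2, h3⟩ := nodup_node ht
    rcases h with rfl | h | h
    · obtain ⟨a, ha⟩ := l.leafSet_nonempty
      obtain ⟨b, hb⟩ := r.leafSet_nonempty
      rw [leafSet_node]
      exact ⟨a, Or.inl ha, b, Or.inr hb, fun e => Set.disjoint_left.1 h3 ha (e ▸ hb)⟩
    · exact hl h1 h
    · exact hr h2 h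

theorem clusters_map (f : α → β) (t : BinTree α) :
    (t.map f).clusters = Set.image f '' t.clusters := by
  induction t with
  | leaf a => simp [BinTree.map, clusters]
  | node l r hl hr =>
    simp only [BinTree.map, clusters, hl, hr, leafSet_node, leafSet_map, Set.image_insert_eq,
      Set.image_union]

theorem mem_clusters_bind {f : α → BinTree β} {t : BinTree α} {A : Set β} :
    A ∈ (t.bind f).clusters ↔
      (∃ B ∈ t.clusters, A = ⋃ a ∈ B, (f a).leafSet) ∨ ∃ a ∈ t.leafSet, A ∈ (f a).clusters := by
  induction t with
  | leaf a => simp [bind, clusters]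
  | node l r hl hr =>
    have e : (node (l.bind f) (r.bind f)).leafSet = ⋃ a ∈ (node l r).leafSet, (f a).leafSet :=
      leafSet_bind f (node l r)
    simp only [bind, clusters, Set.mem_insert_iff, Set.mem_union, hl, hr, e, leafSet_node,
      or_and_right, exists_or, exists_eq_left]
    conv_lhs => rhs; rw [or_or_or_comm]
    exact or_assoc.symm

theorem leafSet_mem_clusters {t : BinTree α} (h : 2 ≤ t.leaves.length) :
    t.leafSet ∈ t.clusters := by
  cases t with
  | leaf a => simp at h
  | node l r => exact Set.mem_insert _ _

theorem exists_eq_leaf {t : BinTree α} (h : t.leaves.length < 2) : ∃ a, t = leaf a := by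
  cases t with
  | leaf a => exact ⟨a, rfl⟩
  | node l r =>
    have := l.leaves_length_pos
    have := r.leaves_length_pos
    rw [leaves_node, List.length_append] at h
    omega

theorem exists_eq_node_leaf_leaf {t : BinTree α} (h : t.leaves.length = 2) :
    ∃ a b, t = node (leaf a) (leaf b) := by
  cases t with
  | leaf a => simp at h
  | node l r =>
    have h1 := l.leaves_length_pos
    have h2 := r.leaves_length_pos
    rw [leaves_node, List.length_append] at h
    obtain ⟨a, rfl⟩ := exists_eq_leaf (t := l) (by omega)
    obtain ⟨b, rfl⟩ := exists_eq_leaf (t := r) (by omega)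
    exact ⟨a, b, rfl⟩

theorem clusters_eq_empty {t : BinTree α} (h : t.leaves.length < 2) : t.clusters = ∅ := by
  obtain ⟨a, rfl⟩ := exists_eq_leaf h
  rfl

theorem nodup_leaves_of_nodup_bind {f : α → BinTree β} {t : BinTree α}
    (h : (t.bind f).leaves.Nodup) :
    t.leaves.Nodup ∧ (∀ a ∈ t.leafSet, (f a).leaves.Nodup) ∧
      ∀ a ∈ t.leafSet, ∀ b ∈ t.leafSet, a ≠ b → Disjoint (f a).leafSet (f b).leafSet := by
  rw [leaves_bind, List.nodup_flatMap] at h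
  refine ⟨h.2.imp fun {a b} hab e => ?_, h.1, fun a ha b hb hab => ?_⟩
  · subst e
    obtain ⟨x, hx⟩ := (f a).leafSet_nonempty
    exact hab hx hx
  · have : Std.Symm (Function.onFun List.Disjoint fun a => (f a).leaves) :=
      ⟨fun _ _ h => List.Disjoint.symm h⟩
    exact Set.disjoint_left.2 fun x hx hy => h.2.forall ha hb hab hx hy

/-! ### Pairs of trees with common leaf labels, up to isomorphism. -/

/-- The number of clusters shared by two trees. -/
noncomputable def matchedCount (T S : BinTree α) : ℕ := (T.clusters ∩ S.clusters).ncard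

/-- The pairs `(T, S)` and `(T', S')` of trees with common leaf labels are isomorphic. -/
def PairIso (T S : BinTree α) (T' S' : BinTree β) : Prop :=
  ∃ f : α → β, (T.map f).Iso T' ∧ (S.map f).Iso S'

theorem PairIso.refl (T S : BinTree α) : PairIso T S T S :=
  ⟨fun a => a, by rw [map_id']; exact Iso.rfl' T, by rw [map_id']; exact Iso.rfl' S⟩

theorem pairIso_map (T S : BinTree α) (f : α → β) : PairIso T S (T.map f) (S.map f) :=
  ⟨f, Iso.rfl' _, Iso.rfl' _⟩

theorem PairIso.trans {T S : BinTree α} {T' S' : BinTree β} {T'' S'' : BinTree γ}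
    (h : PairIso T S T' S') (h' : PairIso T' S' T'' S'') : PairIso T S T'' S'' := by
  obtain ⟨f, h1, h2⟩ := h
  obtain ⟨g, h3, h4⟩ := h'
  refine ⟨fun a => g (f a), ?_, ?_⟩
  · rw [← map_map]; exact (h1.map g).trans h3
  · rw [← map_map]; exact (h2.map g).trans h4

/-- `PairIso` allows any function on labels; distinct labels in the target are what make it
injective on the leaves. -/
theorem injOn_of_iso_map {T : BinTree α} {T' : BinTree β} {f : α → β} (h : (T.map f).Iso T')
    (hT' : T'.leaves.Nodup) : Set.InjOn f T.leafSet := by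
  have := h.leaves_perm.nodup_iff.2 hT'
  rw [leaves_map] at this
  exact fun a ha b hb e => List.inj_on_of_nodup_map this ha hb e

theorem PairIso.symm {T S : BinTree α} {T' S' : BinTree β} (h : PairIso T S T' S')
    (hT' : T'.leaves.Nodup) (hTS : T.leafSet = S.leafSet) : PairIso T' S' T S := by
  obtain ⟨f, h1, h2⟩ := h
  have hf := injOn_of_iso_map h1 hT'
  have : Nonempty α := ⟨T.leafSet_nonempty.some⟩
  -- An inverse is needed on the images of the leaf labels only; its other values play no role.
  refine ⟨Function.invFunOn f T.leafSet, ?_, ?_⟩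
  · have := (h1.map (Function.invFunOn f T.leafSet)).symm
    rwa [map_map, map_eq_self fun a ha => hf.leftInvOn_invFunOn ha] at this
  · have := (h2.map (Function.invFunOn f T.leafSet)).symm
    rwa [map_map, map_eq_self fun a ha => hf.leftInvOn_invFunOn (hTS ▸ ha)] at this

theorem PairIso.length_eq {T S : BinTree α} {T' S' : BinTree β} (h : PairIso T S T' S') :
    T.leaves.length = T'.leaves.length := by
  obtain ⟨f, h1, -⟩ := h
  simpa [leaves_map] using h1.leaves_perm.length_eq

theorem matchedCount_map {T S : BinTree α} {f : α → β} (hf : Set.InjOn f T.leafSet)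
    (hTS : T.leafSet = S.leafSet) : matchedCount (T.map f) (S.map f) = matchedCount T S := by
  have hi : Set.InjOn (Set.image f) {A | A ⊆ T.leafSet} := fun A hA B hB e =>
    (hf.image_eq_image_iff hA hB).1 e
  rw [matchedCount, clusters_map, clusters_map, ← hi.image_inter, Set.InjOn.ncard_image]
  · rfl
  · exact hi.mono fun A hA => subset_of_mem_clusters hA.1
  · exact fun A hA => subset_of_mem_clusters hA
  · exact fun A hA => hTS ▸ subset_of_mem_clusters hA

theorem PairIso.matchedCount_eq {T S : BinTree α} {T' S' : BinTree β} (h : PairIso T S T' S')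
    (hT' : T'.leaves.Nodup) (hTS : T.leafSet = S.leafSet) :
    matchedCount T S = matchedCount T' S' := by
  obtain ⟨f, h1, h2⟩ := h
  rw [← matchedCount_map (injOn_of_iso_map h1 hT') hTS, matchedCount, matchedCount, h1.clusters_eq,
    h2.clusters_eq]

/-- As soon as some cluster is shared, neither tree is a single leaf, so the whole leaf set is
shared too; it must be the only one. -/
theorem clusters_inter_eq_of_matchedCount {T S : BinTree α} (hTS : T.leafSet = S.leafSet)
    (h : matchedCount T S = 1) : T.clusters ∩ S.clusters = {T.leafSet} := by
  obtain ⟨A, hA⟩ := Set.ncard_eq_one.1 h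
  have hA' : A ∈ T.clusters ∩ S.clusters := hA ▸ rfl
  cases T with
  | leaf a => exact hA'.1.elim
  | node l r =>
    cases S with
    | leaf a => exact hA'.2.elim
    | node l' r' =>
      have : (node l r).leafSet ∈ (node l r).clusters ∩ (node l' r').clusters :=
        ⟨Set.mem_insert _ _, by rw [hTS]; exact Set.mem_insert _ _⟩
      rw [hA] at this ⊢
      rw [Set.mem_singleton_iff.1 this]

/-! ### Uniqueness of the planar layout and rigidity of irreducible pairs. -/

/-- A pair of nonempty rearrangements of each other that agree, as sets, on no proper prefix. -/
def IsBlock (p : List α × List α) : Prop :=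
  p.1.Perm p.2 ∧ p.1 ≠ [] ∧ ∀ k, 0 < k → k < p.1.length → ¬ (p.1.take k).Perm (p.2.take k)

/-- A prefix within `l` misses the first entry of `r'`. A longer one contains all of `l`, hence the
last entry of `l'`, which a proper prefix of `r' ++ l'` misses. -/
theorem isBlock_swap {l l' r r' : List α} (hl : l.Perm l') (hr : r.Perm r') (hl0 : l ≠ [])
    (hr0 : r ≠ []) (h : (l ++ r).Nodup) : IsBlock (l ++ r, r' ++ l') := by
  have hnd := h
  rw [List.nodup_append'] at h
  refine ⟨(hl.append hr).trans List.perm_append_comm, by simp [hl0], fun k hk hkn hp => ?_⟩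
  rcases le_or_gt k l.length with hkl | hkl
  · have hr0' : r' ≠ [] := fun e => hr0 (by subst e; exact hr.eq_nil)
    obtain ⟨x, s, rfl⟩ := List.exists_cons_of_ne_nil hr0'
    obtain ⟨j, rfl⟩ := Nat.exists_eq_succ_of_ne_zero hk.ne'
    have hx : x ∈ (l ++ r).take (j + 1) := hp.mem_iff.2 (by simp)
    rw [List.take_append_of_le_length hkl] at hx
    exact h.2.2 (List.mem_of_mem_take hx) (hr.mem_iff.2 (by simp))
  · have hl0' : l' ≠ [] := fun e => hl0 (by subst e; exact hl.eq_nil)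
    obtain ⟨s, x, rfl⟩ := (List.eq_nil_or_concat l').resolve_left hl0'
    rw [List.concat_eq_append] at hl hp
    have hx : x ∈ (l ++ r).take k := by
      rw [List.take_append]
      refine List.mem_append_left _ ?_
      rw [List.take_of_length_le hkl.le]
      exact hl.mem_iff.2 (by simp)
    have hx' := hp.mem_iff.1 hx
    have hlen : k ≤ (r' ++ s).length := by
      have h1 := hl.length_eq
      have h2 := hr.length_eq
      simp at hkn h1 h2 ⊢
      omega
    rw [← List.append_assoc, List.take_append_of_le_length hlen] at hx'
    have hnd' : (r' ++ s ++ [x]).Nodup := by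
      rw [List.append_assoc]
      exact (((hl.append hr).trans List.perm_append_comm).nodup_iff).1 hnd
    rw [List.nodup_append'] at hnd'
    exact hnd'.2.2 (List.mem_of_mem_take hx') (by simp)

/-- The first block can only be the shortest nonempty prefix on which the two concatenations agree
as sets, so it depends on them alone. -/
theorem blocks_unique {B B' : List (List α × List α)} (hB : ∀ p ∈ B, IsBlock p)
    (hB' : ∀ p ∈ B', IsBlock p)
    (h1 : (B.map Prod.fst).flatten = (B'.map Prod.fst).flatten)
    (h2 : (B.map Prod.snd).flatten = (B'.map Prod.snd).flatten) : B = B' := by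
  have key : ∀ (p p' : List α × List α) (x x' y y' : List α), IsBlock p → IsBlock p' →
      p.1 ++ x = p'.1 ++ x' → p.2 ++ y = p'.2 ++ y' → ¬ p.1.length < p'.1.length := by
    intro p p' x x' y y' hp hp' e1 e2 hlt
    refine hp'.2.2 p.1.length (List.length_pos_of_ne_nil hp.2.1) hlt ?_
    have g1 := congrArg (List.take p.1.length) e1
    have g2 := congrArg (List.take p.1.length) e2
    rw [List.take_left, List.take_append_of_le_length hlt.le] at g1
    rw [hp.1.length_eq, List.take_left, List.take_append_of_le_length
      (by rw [← hp.1.length_eq, ← hp'.1.length_eq]; exact hlt.le), ← hp.1.length_eq] at g2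
    rw [← g1, ← g2]
    exact hp.1
  induction B generalizing B' with
  | nil =>
    cases B' with
    | nil => rfl
    | cons p' B' => simp [(hB' p' (by simp)).2.1] at h1
  | cons p B ih =>
    cases B' with
    | nil => simp [(hB p (by simp)).2.1] at h1
    | cons p' B' =>
      simp only [List.map_cons, List.flatten_cons] at h1 h2
      have hp := hB p (by simp)
      have hp' := hB' p' (by simp)
      have hlen : p.1.length = p'.1.length :=
        le_antisymm (not_lt.1 (key p' p _ _ _ _ hp' hp h1.symm h2.symm))
          (not_lt.1 (key p p' _ _ _ _ hp hp' h1 h2))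
      obtain ⟨e1, e1'⟩ := List.append_inj h1 hlen
      obtain ⟨e2, e2'⟩ := List.append_inj h2 (by rw [← hp.1.length_eq, ← hp'.1.length_eq, hlen])
      rw [Prod.ext e1 e2, ih (fun q hq => hB q (by simp [hq])) (fun q hq => hB' q (by simp [hq]))
        e1' e2']

/-- `B` cuts the leaves of `t` and `t'` into corresponding blocks, each of them a single leaf
or a cluster of `t`. -/
def IsBlocks (t t' : BinTree α) (B : List (List α × List α)) : Prop :=
  (B.map Prod.fst).flatten = t.leaves ∧ (B.map Prod.snd).flatten = t'.leaves ∧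
    ∀ p ∈ B, IsBlock p ∧ (p.1.length = 1 ∨ {a | a ∈ p.1} ∈ t.clusters)

theorem IsBlocks.node {l l' r r' : BinTree α} {B C : List (List α × List α)}
    (hB : IsBlocks l l' B) (hC : IsBlocks r r' C) :
    IsBlocks (.node l r) (.node l' r') (B ++ C) := by
  refine ⟨by simp [hB.1, hC.1], by simp [hB.2.1, hC.2.1], fun p hp => ?_⟩
  rcases List.mem_append.1 hp with hp | hp
  · exact ⟨(hB.2.2 p hp).1, (hB.2.2 p hp).2.imp_right fun h => Or.inr (Or.inl h)⟩
  · exact ⟨(hC.2.2 p hp).1, (hC.2.2 p hp).2.imp_right fun h => Or.inr (Or.inr h)⟩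

/-- Descend from the root until a vertex whose children are exchanged, or a leaf; the topmost
exchanged vertices give the blocks. -/
theorem exists_isBlocks {t t' : BinTree α} (h : t.Iso t') (ht : t.leaves.Nodup) :
    ∃ B, IsBlocks t t' B := by
  induction h with
  | leaf a => exact ⟨[([a], [a])], by simp [IsBlocks, IsBlock]; omega⟩
  | node _ _ h1 h2 =>
    obtain ⟨hl, hr, -⟩ := nodup_node ht
    obtain ⟨B, hB⟩ := h1 hl
    obtain ⟨C, hC⟩ := h2 hr
    exact ⟨B ++ C, hB.node hC⟩
  | @swap l l' r r' h h' _ _ =>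
    refine ⟨[(l.leaves ++ r.leaves, r'.leaves ++ l'.leaves)], by simp, by simp, fun p hp => ?_⟩
    rw [List.mem_singleton.1 hp]
    exact ⟨isBlock_swap h.leaves_perm h'.leaves_perm l.leaves_ne_nil r.leaves_ne_nil ht,
      Or.inr (Set.mem_insert _ _)⟩

theorem IsBlocks.ne_nil {t t' : BinTree α} {B : List (List α × List α)} (h : IsBlocks t t' B) :
    B ≠ [] := by
  rintro rfl
  exact t.leaves_ne_nil h.1.symm

theorem length_le_length_flatten {B : List (List α × List α)} (h : ∀ p ∈ B, IsBlock p) :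
    B.length ≤ (B.map Prod.fst).flatten.length := by
  induction B with
  | nil => simp
  | cons p B ih =>
    have h1 := List.length_pos_of_ne_nil (h p (by simp)).2.1
    have h2 := ih fun q hq => h q (by simp [hq])
    rw [List.map_cons, List.flatten_cons, List.length_append, List.length_cons]
    omega

/-- Both trees cut the same pair of layouts into blocks, so the cuts coincide and a block with
several leaves is a common cluster. With the root of the first tree not exchanged there are at least
two blocks, so none is the whole leaf set; by irreducibility all are single leaves. -/
theorem leaves_eq_of_iso_of_iso {l r l' r' S S' : BinTree α} (hl : l.Iso l') (hr : r.Iso r')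
    (hS : S.Iso S') (hnd : (node l r).leaves.Nodup) (h : (node l r).leaves = S.leaves)
    (h' : (node l' r').leaves = S'.leaves)
    (hirr : (node l r).clusters ∩ S.clusters = {(node l r).leafSet}) :
    (node l r).leaves = (node l' r').leaves := by
  obtain ⟨Bl, hBl⟩ := exists_isBlocks hl (nodup_node hnd).1
  obtain ⟨Br, hBr⟩ := exists_isBlocks hr (nodup_node hnd).2.1
  obtain ⟨C, hC⟩ := exists_isBlocks hS (h ▸ hnd)
  have hB := hBl.node hBr
  have hlen : 2 ≤ (Bl ++ Br).length := by
    have h1 := List.length_pos_of_ne_nil hBl.ne_nil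
    have h2 := List.length_pos_of_ne_nil hBr.ne_nil
    rw [List.length_append]; omega
  generalize Bl ++ Br = B at hB hlen
  obtain rfl : B = C := blocks_unique (fun p hp => (hB.2.2 p hp).1) (fun p hp => (hC.2.2 p hp).1)
    (by rw [hB.1, hC.1, h]) (by rw [hB.2.1, hC.2.1, h'])
  have hone : ∀ p ∈ B, p.1.length = 1 := by
    intro p hp
    rcases (hB.2.2 p hp).2 with h1 | h1
    · exact h1
    rcases (hC.2.2 p hp).2 with h2 | h2
    · exact h2
    exfalso
    have h3 : {a | a ∈ p.1} ∈ (node l r).clusters ∩ S.clusters := ⟨h1, h2⟩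
    rw [hirr, Set.mem_singleton_iff] at h3
    -- The block would contain all leaves, but there is another block and it is nonempty.
    have hle : (node l r).leaves.length ≤ p.1.length :=
      (hnd.subperm fun a ha => (Set.ext_iff.1 h3 a).2 ha).length_le
    obtain ⟨s, t, rfl⟩ := List.append_of_mem hp
    have hs := length_le_length_flatten (B := s) fun q hq => (hB.2.2 q (by simp [hq])).1
    have ht := length_le_length_flatten (B := t) fun q hq => (hB.2.2 q (by simp [hq])).1
    rw [← hB.1, List.map_append, List.map_cons, List.flatten_append, List.flatten_cons,
      List.length_append, List.length_append] at hle
    rw [List.length_append, List.length_cons] at hlen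
    omega
  rw [← hB.1, ← hB.2.1]
  congr 1
  refine List.map_congr_left fun p hp => ?_
  obtain ⟨a, ha⟩ := List.length_eq_one_iff.1 (hone p hp)
  have := (hB.2.2 p hp).1.1
  rw [ha] at this ⊢
  exact (List.perm_singleton.1 this.symm).symm

/-- A planar layout of an irreducible pair of trees is unique up to reflection. -/
theorem leaves_eq_or_eq_reverse {T S T' S' : BinTree α} (hT : T.Iso T') (hS : S.Iso S')
    (hnd : T.leaves.Nodup) (h : T.leaves = S.leaves) (h' : T'.leaves = S'.leaves)
    (hirr : T.clusters ∩ S.clusters = {T.leafSet}) :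
    T'.leaves = T.leaves ∨ T'.leaves = T.leaves.reverse := by
  cases hT with
  | leaf a => exact Or.inl rfl
  | node hl hr => exact Or.inl (leaves_eq_of_iso_of_iso hl hr hS hnd h h' hirr).symm
  | @swap l l' r r' hl hr =>
    right
    -- Reflecting the second layout undoes the exchange at the root of the first tree.
    have := leaves_eq_of_iso_of_iso (hl.trans l'.iso_mirror) (hr.trans r'.iso_mirror)
      (hS.trans S'.iso_mirror) hnd h (by
        rw [leaves_mirror, ← h', ← leaves_mirror]; rfl) hirr
    rw [this]
    simp [leaves_mirror]

/-- If the leaves of a pair of trees can be reversed by an isomorphism, then the root of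
each tree halves the leaves. -/
theorem length_eq_of_iso_reverse {l r : BinTree α} {f : α → α}
    (h : ((node l r).map f).Iso (node l r)) (hnd : (node l r).leaves.Nodup)
    (hf : (node l r).leaves.map f = (node l r).leaves.reverse) :
    l.leaves.length = r.leaves.length := by
  obtain ⟨x, s, hx⟩ := List.exists_cons_of_ne_nil l.leaves_ne_nil
  obtain ⟨s', y, hy⟩ := (List.eq_nil_or_concat r.leaves).resolve_left r.leaves_ne_nil
  have hfx : f x = y := by
    rw [leaves_node, hx, hy] at hf
    simp at hf
    exact hf.1
  cases h with
  | node hl hr =>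
    exfalso
    have h1 : y ∈ (l.map f).leafSet := by
      rw [leafSet_map]; exact ⟨x, by simp [mem_leafSet, hx], hfx⟩
    rw [hl.leafSet_eq] at h1
    exact Set.disjoint_left.1 (nodup_node hnd).2.2 h1 (by simp [mem_leafSet, hy])
  | swap hl hr =>
    have := hl.leaves_perm.length_eq
    rwa [leaves_map, List.length_map] at this

/-- An irreducible planar pair of trees with at least three leaves has no nontrivial
automorphism. -/
theorem eq_of_automorphism {T S : BinTree α} {f : α → α} (hT : (T.map f).Iso T)
    (hS : (S.map f).Iso S) (hnd : T.leaves.Nodup) (h : T.leaves = S.leaves)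
    (hirr : matchedCount T S = 1) (h3 : 3 ≤ T.leaves.length) : ∀ a ∈ T.leafSet, f a = a := by
  have hTS : T.leafSet = S.leafSet := by ext a; simp [mem_leafSet, h]
  have hirr' := clusters_inter_eq_of_matchedCount hTS hirr
  rcases leaves_eq_or_eq_reverse hT.symm hS.symm hnd h (by rw [leaves_map, leaves_map, h]) hirr'
    with e | e
  · rw [leaves_map] at e
    exact fun a ha => List.map_inj_left.1 (e.trans (List.map_id _).symm) a ha
  · exfalso
    rw [leaves_map] at e
    cases T with
    | leaf a => simp at h3
    | node l r =>
      cases S with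
      | leaf a =>
        have := congrArg List.length h
        have := r.leaves_length_pos
        have := l.leaves_length_pos
        simp at *; omega
      | node l' r' =>
        have e1 := length_eq_of_iso_reverse hT hnd e
        have e2 := length_eq_of_iso_reverse hS (h ▸ hnd) (by rw [← h, e])
        have e3 := congrArg List.length h
        simp only [leaves_node, List.length_append] at e3 h3
        have e4 := (List.append_inj (s₁ := l.leaves) (s₂ := l'.leaves) h (by omega)).1
        have e5 : l.leafSet = l'.leafSet := by ext a; simp [mem_leafSet, e4]
        -- Equal halves of at least three leaves have at least two leaves each, so the first
        -- children are internal vertices. This is where size two is excluded.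
        have hm : l.leafSet ∈ (node l r).clusters ∩ (node l' r').clusters :=
          ⟨Or.inr (Or.inl (leafSet_mem_clusters (by omega))),
            Or.inr (Or.inl (e5 ▸ leafSet_mem_clusters (by omega)))⟩
        rw [hirr', Set.mem_singleton_iff, leafSet_node] at hm
        obtain ⟨x, hx⟩ := r.leafSet_nonempty
        exact Set.disjoint_left.1 (nodup_node hnd).2.2 (hm ▸ Or.inr hx) hx

end BinTree

/-! ### Uniqueness of the decomposition into a skeleton and pieces. -/

namespace BinTree

variable {α β ι κ : Type}

/-- The pairs of trees `(f i, g i)` are grafted on the leaves of the irreducible pair `(T, S)`. -/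
structure IsGraft (T S : BinTree ι) (f g : ι → BinTree β) : Prop where
  nodup_T : (T.bind f).leaves.Nodup
  nodup_S : (S.bind g).leaves.Nodup
  leafSet_eq : T.leafSet = S.leafSet
  irreducible : matchedCount T S = 1
  leafSet_piece : ∀ i ∈ T.leafSet, (f i).leafSet = (g i).leafSet

theorem subset_of_iUnion_leafSet_subset {T : BinTree ι} {f : ι → BinTree β}
    (h : (T.bind f).leaves.Nodup) {B B' : Set ι} (hB : B ⊆ T.leafSet) (hB' : B' ⊆ T.leafSet)
    (hs : ⋃ i ∈ B, (f i).leafSet ⊆ ⋃ i ∈ B', (f i).leafSet) : B ⊆ B' := by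
  intro i hi
  obtain ⟨x, hx⟩ := (f i).leafSet_nonempty
  obtain ⟨j, hj, hxj⟩ := Set.mem_iUnion₂.1 (hs (Set.mem_biUnion hi hx))
  by_contra hne
  have hij : i ≠ j := fun e => hne (e ▸ hj)
  exact Set.disjoint_left.1
    ((nodup_leaves_of_nodup_bind h).2.2 i (hB hi) j (hB' hj) hij) hx hxj

theorem eq_of_mem_leafSet {T : BinTree ι} {f : ι → BinTree β} (h : (T.bind f).leaves.Nodup)
    {i j : ι} (hi : i ∈ T.leafSet) (hj : j ∈ T.leafSet) {x : β} (hxi : x ∈ (f i).leafSet)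
    (hxj : x ∈ (f j).leafSet) : i = j := by
  by_contra hne
  exact Set.disjoint_left.1 ((nodup_leaves_of_nodup_bind h).2.2 i hi j hj hne) hxi hxj

namespace IsGraft

variable {T S : BinTree ι} {f g : ι → BinTree β}

theorem nodup_skeleton (h : IsGraft T S f g) : T.leaves.Nodup :=
  (nodup_leaves_of_nodup_bind h.nodup_T).1

theorem clusters_inter_skeleton (h : IsGraft T S f g) : T.clusters ∩ S.clusters = {T.leafSet} :=
  clusters_inter_eq_of_matchedCount h.leafSet_eq h.irreducible

theorem leafSet_mem (h : IsGraft T S f g) : T.leafSet ∈ T.clusters ∩ S.clusters := by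
  rw [h.clusters_inter_skeleton]; rfl

theorem leafSet_nontrivial (h : IsGraft T S f g) : T.leafSet.Nontrivial :=
  nontrivial_of_mem_clusters h.nodup_skeleton h.leafSet_mem.1

theorem iUnion_eq (h : IsGraft T S f g) {B : Set ι} (hB : B ⊆ T.leafSet) :
    ⋃ i ∈ B, (g i).leafSet = ⋃ i ∈ B, (f i).leafSet :=
  Set.iUnion₂_congr fun i hi => (h.leafSet_piece i (hB hi)).symm

/-- A cluster of a grafted tree is either a union of pieces over a cluster of the skeleton or lies
within one piece. The two kinds never coincide, because a cluster of the skeleton involves at least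
two disjoint pieces; and by irreducibility the skeletons share only the full cluster. -/
theorem clusters_inter (h : IsGraft T S f g) :
    (T.bind f).clusters ∩ (S.bind g).clusters =
      insert (T.bind f).leafSet (⋃ i ∈ T.leafSet, (f i).clusters ∩ (g i).clusters) := by
  have hS := (nodup_leaves_of_nodup_bind h.nodup_S).1
  ext A
  constructor
  · rintro ⟨h1, h2⟩
    rw [mem_clusters_bind] at h1 h2
    rcases h1 with ⟨B, hB, rfl⟩ | ⟨i, hi, h1⟩ <;> rcases h2 with ⟨C, hC, h2⟩ | ⟨j, hj, h2⟩
    · left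
      have hB' := subset_of_mem_clusters hB
      have hC' : C ⊆ T.leafSet := h.leafSet_eq ▸ subset_of_mem_clusters hC
      rw [h.iUnion_eq hC'] at h2
      obtain rfl : B = C := (subset_of_iUnion_leafSet_subset h.nodup_T hB' hC' h2.le).antisymm
        (subset_of_iUnion_leafSet_subset h.nodup_T hC' hB' h2.ge)
      have : B ∈ T.clusters ∩ S.clusters := ⟨hB, hC⟩
      rw [h.clusters_inter_skeleton, Set.mem_singleton_iff] at this
      rw [leafSet_bind, this]
    · exfalso
      have hj' : j ∈ T.leafSet := h.leafSet_eq ▸ hj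
      have hs : B ⊆ {j} := by
        refine subset_of_iUnion_leafSet_subset h.nodup_T (subset_of_mem_clusters hB)
          (Set.singleton_subset_iff.2 hj') ?_
        rw [Set.biUnion_singleton, h.leafSet_piece j hj']
        exact subset_of_mem_clusters h2
      exact ((nontrivial_of_mem_clusters h.nodup_skeleton hB).mono hs).ne_singleton rfl
    · exfalso
      have hC' : C ⊆ T.leafSet := h.leafSet_eq ▸ subset_of_mem_clusters hC
      have hs : C ⊆ {i} := by
        refine subset_of_iUnion_leafSet_subset h.nodup_T hC'
          (Set.singleton_subset_iff.2 hi) ?_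
        rw [Set.biUnion_singleton, ← h.iUnion_eq hC', ← h2]
        exact subset_of_mem_clusters h1
      exact ((nontrivial_of_mem_clusters hS hC).mono hs).ne_singleton rfl
    · right
      have hj' : j ∈ T.leafSet := h.leafSet_eq ▸ hj
      obtain ⟨x, hx⟩ := (nontrivial_of_mem_clusters
        ((nodup_leaves_of_nodup_bind h.nodup_T).2.1 i hi) h1).nonempty
      obtain rfl : i = j := eq_of_mem_leafSet h.nodup_T hi hj' (subset_of_mem_clusters h1 hx)
        (by rw [h.leafSet_piece j hj']; exact subset_of_mem_clusters h2 hx)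
      exact Set.mem_biUnion hi ⟨h1, h2⟩
  · rintro (rfl | hA)
    · refine ⟨mem_clusters_bind.2 (Or.inl ⟨_, h.leafSet_mem.1, leafSet_bind f T⟩),
        mem_clusters_bind.2 (Or.inl ⟨_, h.leafSet_mem.2, ?_⟩)⟩
      rw [h.iUnion_eq subset_rfl, leafSet_bind]
    · obtain ⟨i, hi, h1, h2⟩ := Set.mem_iUnion₂.1 hA
      exact ⟨mem_clusters_bind.2 (Or.inr ⟨i, hi, h1⟩),
        mem_clusters_bind.2 (Or.inr ⟨i, h.leafSet_eq ▸ hi, h2⟩)⟩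

theorem not_leafSet_bind_subset (h : IsGraft T S f g) {i : ι} (hi : i ∈ T.leafSet) :
    ¬ (T.bind f).leafSet ⊆ (f i).leafSet := by
  intro hs
  rw [leafSet_bind, ← Set.biUnion_singleton i fun i => (f i).leafSet] at hs
  have := subset_of_iUnion_leafSet_subset h.nodup_T subset_rfl (Set.singleton_subset_iff.2 hi) hs
  exact (h.leafSet_nontrivial.mono this).ne_singleton rfl

theorem matchedCount_bind [Fintype ι] (h : IsGraft T S f g) (hu : T.leafSet = Set.univ) :
    matchedCount (T.bind f) (S.bind g) = 1 + ∑ i, matchedCount (f i) (g i) := by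
  have hfin : ∀ i, ((f i).clusters ∩ (g i).clusters).Finite := fun i =>
    (clusters_finite _).subset Set.inter_subset_left
  rw [matchedCount, h.clusters_inter, Set.ncard_insert_of_notMem ?_
    (Set.Finite.biUnion (Set.toFinite _) fun i _ => hfin i), hu, add_comm]
  · congr 1
    simp only [Set.mem_univ, Set.iUnion_true]
    rw [Set.ncard_iUnion_of_finite hfin, finsum_eq_sum_of_fintype]
    · rfl
    · intro i j hij
      refine Set.disjoint_left.2 fun A hA hA' => hij ?_
      have hi : i ∈ T.leafSet := hu ▸ Set.mem_univ i
      have hj : j ∈ T.leafSet := hu ▸ Set.mem_univ j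
      obtain ⟨x, hx⟩ := (nontrivial_of_mem_clusters
        ((nodup_leaves_of_nodup_bind h.nodup_T).2.1 i hi) hA.1).nonempty
      exact eq_of_mem_leafSet h.nodup_T hi hj (subset_of_mem_clusters hA.1 hx)
        (subset_of_mem_clusters hA'.1 hx)
  · intro hm
    obtain ⟨i, hi, h1, h2⟩ := Set.mem_iUnion₂.1 hm
    exact h.not_leafSet_bind_subset hi (subset_of_mem_clusters h1)

variable {T' S' : BinTree κ} {f' g' : κ → BinTree β}

/-- A piece with at least two leaves is a common cluster other than the whole, hence lies within a
piece of the other graft; for a single leaf this is clear. -/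
theorem exists_leafSet_subset (h : IsGraft T S f g) (h' : IsGraft T' S' f' g')
    (hT : (T.bind f).Iso (T'.bind f')) (hS : (S.bind g).Iso (S'.bind g')) {i : ι}
    (hi : i ∈ T.leafSet) : ∃ j ∈ T'.leafSet, (f i).leafSet ⊆ (f' j).leafSet := by
  by_cases h2 : 2 ≤ (f i).leaves.length
  · have hg : 2 ≤ (g i).leaves.length := by
      have hf := (nodup_leaves_of_nodup_bind h.nodup_T).2.1 i hi
      have : (f i).leaves.Subperm (g i).leaves := hf.subperm fun a ha => by
        have : a ∈ (f i).leafSet := ha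
        rw [h.leafSet_piece i hi] at this
        exact this
      exact h2.trans this.length_le
    have hm : (f i).leafSet ∈ (T.bind f).clusters ∩ (S.bind g).clusters := by
      rw [h.clusters_inter]
      exact Or.inr (Set.mem_biUnion hi
        ⟨leafSet_mem_clusters h2, h.leafSet_piece i hi ▸ leafSet_mem_clusters hg⟩)
    rw [hT.clusters_eq, hS.clusters_eq, h'.clusters_inter] at hm
    rcases hm with hm | hm
    · rw [← hT.leafSet_eq] at hm
      exact (h.not_leafSet_bind_subset hi hm.ge).elim
    · obtain ⟨j, hj, h3, -⟩ := Set.mem_iUnion₂.1 hm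
      exact ⟨j, hj, subset_of_mem_clusters h3⟩
  · obtain ⟨x, hx⟩ := exists_eq_leaf (not_le.1 h2)
    have hm : x ∈ (T.bind f).leafSet := by
      rw [leafSet_bind]; exact Set.mem_biUnion hi (by simp [hx])
    rw [hT.leafSet_eq, leafSet_bind] at hm
    obtain ⟨j, hj, h3⟩ := Set.mem_iUnion₂.1 hm
    exact ⟨j, hj, by simpa [hx] using h3⟩

/-- The pieces of a graft are determined by the grafted pair. -/
theorem exists_leafSet_eq (h : IsGraft T S f g) (h' : IsGraft T' S' f' g')
    (hT : (T.bind f).Iso (T'.bind f')) (hS : (S.bind g).Iso (S'.bind g')) {i : ι}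
    (hi : i ∈ T.leafSet) : ∃ j ∈ T'.leafSet, (f i).leafSet = (f' j).leafSet := by
  obtain ⟨j, hj, h1⟩ := h.exists_leafSet_subset h' hT hS hi
  obtain ⟨k, hk, h2⟩ := h'.exists_leafSet_subset h hT.symm hS.symm hj
  obtain ⟨x, hx⟩ := (f i).leafSet_nonempty
  obtain rfl := eq_of_mem_leafSet h.nodup_T hi hk hx (h2 (h1 hx))
  exact ⟨j, hj, h1.antisymm h2⟩

end IsGraft

/-- Isomorphic grafted trees with the same pieces have isomorphic skeletons and pieces. -/
theorem iso_of_iso_bind {T : BinTree ι} {T' : BinTree κ} {f : ι → BinTree β} {f' : κ → BinTree β}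
    {τ : ι → κ} (h : (T.bind f).Iso (T'.bind f')) (hT : (T.bind f).leaves.Nodup)
    (hτ : ∀ i ∈ T.leafSet, (f i).leafSet = (f' (τ i)).leafSet)
    (hτ' : ∀ i ∈ T.leafSet, ∀ j ∈ T'.leafSet, ∀ x ∈ (f i).leafSet, x ∈ (f' j).leafSet → τ i = j) :
    (T.map τ).Iso T' ∧ ∀ i ∈ T.leafSet, (f i).Iso (f' (τ i)) := by
  induction T generalizing T' with
  | leaf i =>
    -- The piece at any leaf of `T'` meets `f i`, so that leaf is `τ i`; distinct labels leave room
    -- for only one.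
    obtain rfl : T' = leaf (τ i) := by
      have hT' : (T'.bind f').leaves.Nodup := (h.leaves_perm.nodup_iff).1 hT
      have hj : ∀ j ∈ T'.leafSet, τ i = j := by
        intro j hj
        obtain ⟨x, hx⟩ := (f' j).leafSet_nonempty
        refine hτ' i (by simp) j hj x ?_ hx
        have : x ∈ (T'.bind f').leafSet := by
          rw [leafSet_bind]; exact Set.mem_biUnion hj hx
        rwa [← h.leafSet_eq] at this
      cases T' with
      | leaf j => rw [hj j (by simp)]
      | node l r =>
        obtain ⟨a, ha⟩ := l.leafSet_nonempty
        obtain ⟨b, hb⟩ := r.leafSet_nonempty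
        have hd := (nodup_node (nodup_leaves_of_nodup_bind hT').1).2.2
        have e : a = b := (hj a (by simp [ha])).symm.trans (hj b (by simp [hb]))
        exact (Set.disjoint_left.1 hd ha (e ▸ hb)).elim
    refine ⟨Iso.leaf _, fun j hj => ?_⟩
    rw [leafSet_leaf, Set.mem_singleton_iff] at hj
    subst hj
    exact h
  | node l r hl hr =>
    obtain ⟨nl, nr, -⟩ := nodup_node hT
    simp only [leafSet_node, Set.mem_union] at hτ hτ'
    cases T' with
    | leaf j =>
      exfalso
      have hj : ∀ i ∈ (node l r).leafSet, τ i = j := by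
        intro i hi
        obtain ⟨x, hx⟩ := (f i).leafSet_nonempty
        refine hτ' i (by simpa using hi) j (by simp) x hx ?_
        have : x ∈ ((node l r).bind f).leafSet := by
          rw [leafSet_bind]; exact Set.mem_biUnion hi hx
        rwa [h.leafSet_eq] at this
      obtain ⟨a, ha⟩ := l.leafSet_nonempty
      obtain ⟨b, hb⟩ := r.leafSet_nonempty
      have hd := (nodup_node (nodup_leaves_of_nodup_bind hT).1).2.2
      have e : (f a).leafSet = (f b).leafSet := by
        rw [hτ a (Or.inl ha), hτ b (Or.inr hb), hj a (by simp [ha]), hj b (by simp [hb])]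
      obtain ⟨x, hx⟩ := (f a).leafSet_nonempty
      have := eq_of_mem_leafSet hT (i := a) (j := b) (by simp [ha]) (by simp [hb]) hx (e ▸ hx)
      exact Set.disjoint_left.1 hd ha (this ▸ hb)
    | node l' r' =>
      simp only [leafSet_node, Set.mem_union] at hτ'
      cases h with
      | node h1 h2 =>
        obtain ⟨a1, b1⟩ := hl h1 nl (fun i hi => hτ i (Or.inl hi))
          fun i hi j hj => hτ' i (Or.inl hi) j (Or.inl hj)
        obtain ⟨a2, b2⟩ := hr h2 nr (fun i hi => hτ i (Or.inr hi))
          fun i hi j hj => hτ' i (Or.inr hi) j (Or.inr hj)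
        refine ⟨Iso.node a1 a2, fun i hi => ?_⟩
        rw [leafSet_node] at hi
        exact hi.elim (b1 i) (b2 i)
      | swap h1 h2 =>
        obtain ⟨a1, b1⟩ := hl h1 nl (fun i hi => hτ i (Or.inl hi))
          fun i hi j hj => hτ' i (Or.inl hi) j (Or.inr hj)
        obtain ⟨a2, b2⟩ := hr h2 nr (fun i hi => hτ i (Or.inr hi))
          fun i hi j hj => hτ' i (Or.inr hi) j (Or.inl hj)
        refine ⟨Iso.swap a1 a2, fun i hi => ?_⟩
        rw [leafSet_node] at hi
        exact hi.elim (b1 i) (b2 i)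

/-- The skeleton and the pieces of a graft are unique up to isomorphism. -/
theorem IsGraft.exists_iso {T S : BinTree ι} {f g : ι → BinTree β} {T' S' : BinTree κ}
    {f' g' : κ → BinTree β} (h : IsGraft T S f g) (h' : IsGraft T' S' f' g')
    (hT : (T.bind f).Iso (T'.bind f')) (hS : (S.bind g).Iso (S'.bind g')) :
    ∃ τ : ι → κ, (T.map τ).Iso T' ∧ (S.map τ).Iso S' ∧
      ∀ i ∈ T.leafSet, (f i).Iso (f' (τ i)) ∧ (g i).Iso (g' (τ i)) := by
  have : Nonempty κ := ⟨T'.leafSet_nonempty.some⟩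
  choose! τ hτ hτ' using fun i (hi : i ∈ T.leafSet) => h.exists_leafSet_eq h' hT hS hi
  have key : ∀ i ∈ T.leafSet, ∀ j ∈ T'.leafSet, ∀ x ∈ (f i).leafSet, x ∈ (f' j).leafSet → τ i = j :=
    fun i hi j hj x hx hxj => eq_of_mem_leafSet h'.nodup_T (hτ i hi) hj (hτ' i hi ▸ hx) hxj
  obtain ⟨a1, b1⟩ := iso_of_iso_bind hT h.nodup_T hτ' key
  obtain ⟨a2, b2⟩ := iso_of_iso_bind (τ := τ) hS h.nodup_S
    (by
      rw [← h.leafSet_eq]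
      intro i hi
      rw [← h.leafSet_piece i hi, ← h'.leafSet_piece _ (hτ i hi), hτ' i hi])
    (by
      rw [← h.leafSet_eq, ← h'.leafSet_eq]
      intro i hi j hj x hx hxj
      exact key i hi j hj x (h.leafSet_piece i hi ▸ hx) (h'.leafSet_piece j hj ▸ hxj))
  exact ⟨τ, a1, a2, fun i hi => ⟨b1 i hi, b2 i (h.leafSet_eq ▸ hi)⟩⟩

end BinTree

/-! ### Existence of the decomposition, by contracting maximal common clusters. -/

/-- Two cuttings of one list that refine each other are equal. Both first blocks contain the first
entry, and entries do not repeat, so the first blocks lie in one another. -/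
theorem List.eq_of_flatten_eq {α : Type*} {K K' : List (List α)} (h : K.flatten = K'.flatten)
    (hnd : K.flatten.Nodup) (hK : ∀ b ∈ K, b ≠ []) (hK' : ∀ b ∈ K', b ≠ [])
    (hs : ∀ b ∈ K, ∃ b' ∈ K', b ⊆ b') (hs' : ∀ b' ∈ K', ∃ b ∈ K, b' ⊆ b) : K = K' := by
  have first : ∀ (b b' : List α) (L L' : List (List α)), b ++ L.flatten = b' ++ L'.flatten →
      (b ++ L.flatten).Nodup → b ≠ [] → b' ≠ [] → (∃ c ∈ b' :: L', b ⊆ c) → b ⊆ b' := by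
    rintro b b' L L' e hnd hb hb' ⟨c, hc, hbc⟩
    rcases List.mem_cons.1 hc with rfl | hcL
    · exact hbc
    exfalso
    obtain ⟨x, s, rfl⟩ := List.exists_cons_of_ne_nil hb
    obtain ⟨x', s', rfl⟩ := List.exists_cons_of_ne_nil hb'
    obtain rfl : x = x' := by simpa using congrArg List.head? e
    rw [e, List.nodup_append'] at hnd
    exact @hnd.2.2 x (by simp) (List.mem_flatten_of_mem hcL (hbc (by simp)))
  have rest : ∀ (b : List α) (L L' : List (List α)), (b ++ L.flatten).Nodup →
      (∀ c ∈ b :: L, c ≠ []) → (∀ c ∈ b :: L, ∃ c' ∈ b :: L', c ⊆ c') →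
      ∀ c ∈ L, ∃ c' ∈ L', c ⊆ c' := by
    intro b L L' hnd h0 hs c hc
    obtain ⟨c', hc', hcc⟩ := hs c (by simp [hc])
    rcases List.mem_cons.1 hc' with rfl | hc'
    · exfalso
      obtain ⟨x, hx⟩ := List.exists_mem_of_ne_nil _ (h0 c (by simp [hc]))
      rw [List.nodup_append'] at hnd
      exact hnd.2.2 (hcc hx) (List.mem_flatten_of_mem hc hx)
    · exact ⟨c', hc', hcc⟩
  induction K generalizing K' with
  | nil =>
    cases K' with
    | nil => rfl
    | cons b' K' => simp [hK' b' (by simp)] at h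
  | cons b K ih =>
    cases K' with
    | nil => simp [hK b (by simp)] at h
    | cons b' K' =>
      rw [List.flatten_cons, List.flatten_cons] at h
      rw [List.flatten_cons] at hnd
      have h1 := first b b' K K' h hnd (hK b (by simp)) (hK' b' (by simp)) (hs b (by simp))
      have h2 := first b' b K' K h.symm (h ▸ hnd) (hK' b' (by simp)) (hK b (by simp))
        (hs' b' (by simp))
      have hlen : b.length = b'.length :=
        le_antisymm ((List.nodup_append'.1 hnd).1.subperm h1).length_le
          ((List.nodup_append'.1 (h ▸ hnd)).1.subperm h2).length_le
      obtain ⟨rfl, e⟩ := List.append_inj h hlen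
      rw [ih e (List.nodup_append'.1 hnd).2.1 (fun c hc => hK c (by simp [hc]))
        (fun c hc => hK' c (by simp [hc])) (rest b K K' hnd hK hs)
        (rest b K' K (h ▸ hnd) hK' hs')]

namespace BinTree

variable {α β : Type}

open Classical in
/-- The topmost subtrees whose leaf sets satisfy `Q` are contracted to leaves, labelled by
the subtrees themselves. -/
noncomputable def contract (Q : Set α → Prop) : BinTree α → BinTree (BinTree α)
  | leaf a => leaf (leaf a)
  | node l r =>
    if Q (node l r).leafSet then leaf (node l r) else node (l.contract Q) (r.contract Q)

theorem contract_bind (Q : Set α → Prop) (t : BinTree α) : (t.contract Q).bind id = t := by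
  induction t with
  | leaf a => rfl
  | node l r hl hr =>
    rw [contract]
    split_ifs
    · rfl
    · rw [bind, hl, hr]

theorem not_of_mem_clusters_contract {Q : Set α → Prop} {t : BinTree α} {A : Set (BinTree α)}
    (h : A ∈ (t.contract Q).clusters) : ¬ Q (⋃ u ∈ A, u.leafSet) := by
  induction t with
  | leaf a => exact h.elim
  | node l r hl hr =>
    rw [contract] at h
    split_ifs at h with hQ
    · exact h.elim
    · rcases h with rfl | h | h
      · have e := leafSet_bind id (node (l.contract Q) (r.contract Q))
        rw [bind, contract_bind, contract_bind] at e
        rw [e] at hQ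
        exact hQ
      · exact hl h
      · exact hr h

theorem mem_leaves_contract {Q : Set α → Prop} {t u : BinTree α}
    (h : u ∈ (t.contract Q).leaves) :
    (∃ a ∈ t.leafSet, u = leaf a) ∨ (u.leafSet ∈ t.clusters ∧ Q u.leafSet) := by
  induction t with
  | leaf a =>
    left
    exact ⟨a, by simp, by simpa [contract] using h⟩
  | node l r hl hr =>
    rw [contract] at h
    split_ifs at h with hQ
    · rw [leaves_leaf, List.mem_singleton] at h
      subst h
      exact Or.inr ⟨Set.mem_insert _ _, hQ⟩
    · rw [leafSet_node]
      rcases List.mem_append.1 h with h | h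
      · rcases hl h with ⟨a, ha, e⟩ | ⟨h1, h2⟩
        · exact Or.inl ⟨a, Or.inl ha, e⟩
        · exact Or.inr ⟨Or.inr (Or.inl h1), h2⟩
      · rcases hr h with ⟨a, ha, e⟩ | ⟨h1, h2⟩
        · exact Or.inl ⟨a, Or.inr ha, e⟩
        · exact Or.inr ⟨Or.inr (Or.inr h1), h2⟩

theorem exists_subset_of_mem_clusters {Q : Set α → Prop} {t : BinTree α} {A : Set α}
    (hA : A ∈ t.clusters) (hQ : Q A) : ∃ u ∈ (t.contract Q).leaves, A ⊆ u.leafSet := by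
  induction t with
  | leaf a => exact hA.elim
  | node l r hl hr =>
    rw [contract]
    split_ifs with h
    · exact ⟨_, by simp, subset_of_mem_clusters hA⟩
    · rcases hA with rfl | hA | hA
      · exact (h hQ).elim
      · obtain ⟨u, hu, hAu⟩ := hl hA
        exact ⟨u, by simp [hu], hAu⟩
      · obtain ⟨u, hu, hAu⟩ := hr hA
        exact ⟨u, by simp [hu], hAu⟩

theorem exists_mem_leaves_contract (Q : Set α → Prop) {t : BinTree α} {a : α}
    (ha : a ∈ t.leafSet) : ∃ u ∈ (t.contract Q).leaves, a ∈ u.leafSet := by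
  rw [← contract_bind Q t, leafSet_bind] at ha
  obtain ⟨u, hu, h⟩ := Set.mem_iUnion₂.1 ha
  exact ⟨u, hu, h⟩

theorem flatten_leaves_contract (Q : Set α → Prop) (t : BinTree α) :
    ((t.contract Q).leaves.map leaves).flatten = t.leaves := by
  conv_rhs => rw [← contract_bind Q t, leaves_bind]
  rfl

/-- A set contracted in one tree is also a cluster of the other and satisfies `Q`, so it lies within
a set contracted there. The two cuttings of the leaf list therefore refine each other. -/
theorem leaves_contract_eq {Q : Set α → Prop} {T S : BinTree α} (h : T.leaves = S.leaves)
    (hnd : T.leaves.Nodup) (hQ : ∀ A, Q A → A ∈ T.clusters ∧ A ∈ S.clusters) :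
    (T.contract Q).leaves.map leaves = (S.contract Q).leaves.map leaves := by
  have key : ∀ T S : BinTree α, T.leaves = S.leaves → (∀ A, Q A → A ∈ S.clusters) →
      ∀ b ∈ (T.contract Q).leaves.map leaves, ∃ b' ∈ (S.contract Q).leaves.map leaves,
        b ⊆ b' := by
    intro T S h hQ b hb
    obtain ⟨u, hu, rfl⟩ := List.mem_map.1 hb
    rcases mem_leaves_contract hu with ⟨a, ha, rfl⟩ | ⟨-, h2⟩
    · obtain ⟨v, hv, hav⟩ := exists_mem_leaves_contract Q (t := S) (a := a) (by
        rwa [mem_leafSet, ← h])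
      exact ⟨_, List.mem_map_of_mem hv, by simpa using mem_leafSet.1 hav⟩
    · obtain ⟨v, hv, huv⟩ := exists_subset_of_mem_clusters (hQ _ h2) h2
      exact ⟨_, List.mem_map_of_mem hv, huv⟩
  have ne : ∀ T : BinTree α, ∀ b ∈ (T.contract Q).leaves.map leaves, b ≠ [] := by
    intro T b hb
    obtain ⟨u, -, rfl⟩ := List.mem_map.1 hb
    exact u.leaves_ne_nil
  exact List.eq_of_flatten_eq (by rw [flatten_leaves_contract, flatten_leaves_contract, h])
    (by rwa [flatten_leaves_contract]) (ne T) (ne S) (key T S h fun A hA => (hQ A hA).2)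
    (key S T h.symm fun A hA => (hQ A hA).1)

/-- A tree with distinct labels is a relabelling of a tree with leaves `0, 1, ..., k - 1`. -/
theorem exists_indexed {t : BinTree β} (ht : t.leaves.Nodup) {k : ℕ} (hk : t.leaves.length = k) :
    ∃ (t' : BinTree (Fin k)) (e : Fin k → β), t'.leaves = List.finRange k ∧ t'.map e = t := by
  classical
  subst hk
  have : NeZero t.leaves.length := ⟨t.leaves_length_pos.ne'⟩
  refine ⟨t.map fun b => Fin.ofNat _ (t.leaves.idxOf b), t.leaves.get, ?_, ?_⟩
  · rw [leaves_map]
    refine List.ext_getElem (by simp) fun i h1 h2 => ?_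
    rw [List.length_map] at h1
    simp [Fin.ext_iff, ht.idxOf_getElem, Nat.mod_eq_of_lt h1]
  · rw [map_map]
    refine map_eq_self fun b hb => ?_
    have h1 : t.leaves.idxOf b < t.leaves.length := List.idxOf_lt_length_of_mem hb
    simp [Nat.mod_eq_of_lt h1]

/-- Every planar pair of trees with at least two leaves is obtained by grafting planar pairs on
an irreducible one. -/
theorem exists_graft {T S : BinTree α} (h : T.leaves = S.leaves) (hnd : T.leaves.Nodup)
    (h2 : 2 ≤ T.leaves.length) :
    ∃ (k : ℕ) (T₀ S₀ : BinTree (Fin k)) (f g : Fin k → BinTree α),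
      T₀.leaves = List.finRange k ∧ S₀.leaves = List.finRange k ∧ matchedCount T₀ S₀ = 1 ∧
      T₀.bind f = T ∧ S₀.bind g = S ∧ ∀ i, (f i).leaves = (g i).leaves := by
  -- The pieces are the maximal common clusters other than the whole, and the leaves in none of
  -- these.
  set Q : Set α → Prop := fun A => A ∈ T.clusters ∩ S.clusters ∧ A ≠ T.leafSet
  have hK := leaves_contract_eq (Q := Q) h hnd fun A hA => hA.1
  have hlen : (S.contract Q).leaves.length = (T.contract Q).leaves.length := by
    have := congrArg List.length hK
    rw [List.length_map, List.length_map] at this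
    exact this.symm
  have ndT : (T.contract Q).leaves.Nodup :=
    (nodup_leaves_of_nodup_bind (f := id) (by rwa [contract_bind])).1
  have ndS : (S.contract Q).leaves.Nodup :=
    (nodup_leaves_of_nodup_bind (f := id) (by rwa [contract_bind, ← h])).1
  obtain ⟨k, hkT⟩ : ∃ k, (T.contract Q).leaves.length = k := ⟨_, rfl⟩
  rw [hkT] at hlen
  obtain ⟨T₀, f, hT₀, hf⟩ := exists_indexed ndT hkT
  obtain ⟨S₀, g, hS₀, hg⟩ := exists_indexed ndS hlen
  have eT : T₀.bind f = T := by
    rw [← contract_bind Q T]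
    conv_rhs => rw [← hf, bind_map]
    rfl
  have eS : S₀.bind g = S := by
    rw [← contract_bind Q S]
    conv_rhs => rw [← hg, bind_map]
    rfl
  have efg : ∀ i, (f i).leaves = (g i).leaves := by
    rw [← hf, ← hg, leaves_map, leaves_map, hT₀, hS₀, List.map_map, List.map_map] at hK
    exact fun i => List.map_inj_left.1 hK i (List.mem_finRange i)
  have hk : 2 ≤ k := by
    rw [← hkT]
    clear * - h2
    cases T with
    | leaf a => simp at h2
    | node l r =>
      -- The root is not contracted, as `Q` excludes the whole leaf set.
      rw [contract, if_neg fun hq => hq.2 rfl, leaves_node, List.length_append]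
      have h1 := (l.contract Q).leaves_length_pos
      have h2 := (r.contract Q).leaves_length_pos
      omega
  refine ⟨_, T₀, S₀, f, g, hT₀, hS₀, ?_, eT, eS, efg⟩
  have uT : T₀.leafSet = Set.univ := by ext a; simp [mem_leafSet, hT₀]
  have uS : S₀.leafSet = Set.univ := by ext a; simp [mem_leafSet, hS₀]
  refine Set.ncard_eq_one.2 ⟨Set.univ, Set.eq_singleton_iff_unique_mem.2 ⟨⟨?_, ?_⟩, ?_⟩⟩
  · rw [← uT]; exact leafSet_mem_clusters (by rwa [hT₀, List.length_finRange])
  · rw [← uS]; exact leafSet_mem_clusters (by rwa [hS₀, List.length_finRange])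
  · rintro A ⟨hA, hA'⟩
    have h1 : ⋃ i ∈ A, (f i).leafSet ∈ T.clusters := by
      rw [← eT]; exact mem_clusters_bind.2 (Or.inl ⟨A, hA, rfl⟩)
    have h3 : ⋃ i ∈ A, (f i).leafSet ∈ S.clusters := by
      rw [← eS]
      refine mem_clusters_bind.2 (Or.inl ⟨A, hA', Set.iUnion₂_congr fun i _ => ?_⟩)
      ext a; simp [mem_leafSet, efg]
    -- A vertex that survives the contraction does not satisfy `Q`, so a common cluster of the
    -- skeletons must come from the roots.
    have h4 : ¬ Q (⋃ i ∈ A, (f i).leafSet) := by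
      have : f '' A ∈ (T.contract Q).clusters := by
        rw [← hf, clusters_map]; exact Set.mem_image_of_mem _ hA
      have := not_of_mem_clusters_contract this
      rwa [Set.biUnion_image] at this
    have h5 : ⋃ i ∈ A, (f i).leafSet = T.leafSet := by
      by_contra hne
      exact h4 ⟨⟨h1, h3⟩, hne⟩
    rw [← eT, leafSet_bind, uT] at h5
    exact Set.univ_subset_iff.1 (subset_of_iUnion_leafSet_subset (T := T₀) (f := f)
      (by rwa [eT]) (by rw [uT]) (by rw [uT]; exact Set.subset_univ _) h5.ge)

end BinTree

/-! ### Drawings, skeletons and grafting. -/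

namespace BinTree

variable {β γ ι κ : Type}

/-- The pieces have disjoint labels, so their relabellings glue to a single function. -/
theorem pairIso_bind {T S : BinTree ι} {f g : ι → BinTree β} {T' S' : BinTree κ}
    {f' g' : κ → BinTree γ} {τ : ι → κ} (hnd : (T.bind f).leaves.Nodup)
    (hTS : T.leafSet = S.leafSet) (hfg : ∀ i ∈ T.leafSet, (f i).leafSet = (g i).leafSet)
    (hT : (T.map τ).Iso T') (hS : (S.map τ).Iso S')
    (h : ∀ i ∈ T.leafSet, PairIso (f i) (g i) (f' (τ i)) (g' (τ i))) :
    PairIso (T.bind f) (S.bind g) (T'.bind f') (S'.bind g') := by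
  have : Nonempty γ := ⟨(T'.bind f').leafSet_nonempty.some⟩
  have : Nonempty ι := ⟨T.leafSet_nonempty.some⟩
  choose! φ hφ hφ' using h
  have hex : ∀ x, ∃ j, ∀ i ∈ T.leafSet, x ∈ (f i).leafSet → i = j := by
    intro x
    by_cases hx : ∃ j ∈ T.leafSet, x ∈ (f j).leafSet
    · obtain ⟨j, hj, hxj⟩ := hx
      exact ⟨j, fun i hi hxi => eq_of_mem_leafSet hnd hi hj hxi hxj⟩
    · exact ⟨Classical.arbitrary ι, fun i hi hxi => (hx ⟨i, hi, hxi⟩).elim⟩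
  choose idx hidx using hex
  refine ⟨fun x => φ (idx x) x, ?_, ?_⟩
  · rw [map_bind]
    refine (iso_bind_right (g := fun i => f' (τ i)) fun i hi => ?_).trans ?_
    · rw [map_congr (g := φ i) fun x hx => by rw [← hidx x i hi hx]]
      exact hφ i hi
    · rw [← bind_map]
      exact hT.bind_left f'
  · rw [map_bind]
    refine (iso_bind_right (g := fun i => g' (τ i)) fun i hi => ?_).trans ?_
    · rw [← hTS] at hi
      rw [map_congr (g := φ i) fun x hx => by rw [← hidx x i hi (hfg i hi ▸ hx)]]
      exact hφ' i hi
    · rw [← bind_map]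
      exact hS.bind_left g'

end BinTree

open BinTree

/-- A pair of trees in a planar layout; the leaves with the same label are matched. -/
structure Drawing where
  T : BinTree ℕ
  S : BinTree ℕ
  nodup : T.leaves.Nodup
  leaves_eq : T.leaves = S.leaves

namespace Drawing

theorem leafSet_eq (d : Drawing) : d.T.leafSet = d.S.leafSet := by
  ext a; simp [mem_leafSet, d.leaves_eq]

instance setoid : Setoid Drawing where
  r d d' := PairIso d.T d.S d'.T d'.S
  iseqv := ⟨fun _ => PairIso.refl _ _, fun {_ d'} h => h.symm d'.nodup (leafSet_eq _),
    fun h h' => h.trans h'⟩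

theorem equiv_def {d d' : Drawing} : d ≈ d' ↔ PairIso d.T d.S d'.T d'.S := Iff.rfl

def size (d : Drawing) : ℕ := d.T.leaves.length

noncomputable def matched (d : Drawing) : ℕ := matchedCount d.T d.S

theorem size_pos (d : Drawing) : 0 < d.size := d.T.leaves_length_pos

theorem size_congr {d d' : Drawing} (h : d ≈ d') : d.size = d'.size :=
  PairIso.length_eq (equiv_def.1 h)

theorem matched_congr {d d' : Drawing} (h : d ≈ d') : d.matched = d'.matched :=
  PairIso.matchedCount_eq (equiv_def.1 h) d'.nodup d.leafSet_eq

theorem matched_eq_zero {d : Drawing} (h : d.size = 1) : d.matched = 0 := by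
  rw [matched, matchedCount, clusters_eq_empty (by rw [size] at h; omega), Set.empty_inter,
    Set.ncard_empty]

theorem exists_indexed (d : Drawing) {k : ℕ} (hk : d.size = k) :
    ∃ T S : BinTree (Fin k), T.leaves = List.finRange k ∧ S.leaves = List.finRange k ∧
      PairIso T S d.T d.S := by
  obtain ⟨T', e, hT', hT⟩ := BinTree.exists_indexed d.nodup hk
  obtain ⟨S', e', hS', hS⟩ := BinTree.exists_indexed (t := d.S) (k := k) (d.leaves_eq ▸ d.nodup)
    (by rw [← d.leaves_eq]; exact hk)
  obtain rfl : e = e' := by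
    have := d.leaves_eq
    rw [← hT, ← hS, leaves_map, leaves_map, hT', hS'] at this
    exact funext fun i => List.map_inj_left.1 this i (List.mem_finRange i)
  exact ⟨T', S', hT', hS', by rw [← hT, ← hS]; exact pairIso_map _ _ _⟩

end Drawing

/-- An irreducible pair of trees in a planar layout, with the matched leaves numbered from first
to last. -/
structure Skeleton (k : ℕ) where
  T : BinTree (Fin k)
  S : BinTree (Fin k)
  leaves_T : T.leaves = List.finRange k
  leaves_S : S.leaves = List.finRange k
  irreducible : matchedCount T S = 1

namespace Skeleton

variable {k k' : ℕ}

theorem leafSet_T (K : Skeleton k) : K.T.leafSet = Set.univ := by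
  ext a; simp [mem_leafSet, K.leaves_T]

theorem leafSet_S (K : Skeleton k) : K.S.leafSet = Set.univ := by
  ext a; simp [mem_leafSet, K.leaves_S]

theorem leafSet_eq (K : Skeleton k) : K.T.leafSet = K.S.leafSet := by
  rw [K.leafSet_T, K.leafSet_S]

theorem nodup_T (K : Skeleton k) : K.T.leaves.Nodup := by
  rw [K.leaves_T]; exact List.nodup_finRange k

theorem two_le (K : Skeleton k) : 2 ≤ k := by
  by_contra hk
  have := K.irreducible
  rw [matchedCount, clusters_eq_empty (by rw [K.leaves_T, List.length_finRange]; omega),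
    Set.empty_inter, Set.ncard_empty] at this
  exact zero_ne_one this

def toDrawing (K : Skeleton k) : Drawing where
  T := K.T.map Fin.val
  S := K.S.map Fin.val
  nodup := by
    rw [leaves_map]; exact K.nodup_T.map Fin.val_injective
  leaves_eq := by rw [leaves_map, leaves_map, K.leaves_T, K.leaves_S]

theorem size_toDrawing (K : Skeleton k) : K.toDrawing.size = k := by
  simp [toDrawing, Drawing.size, leaves_map, K.leaves_T]

theorem pairIso_of_toDrawing_equiv {K : Skeleton k} {K' : Skeleton k'}
    (h : K.toDrawing ≈ K'.toDrawing) : PairIso K.T K.S K'.T K'.S :=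
  ((pairIso_map K.T K.S Fin.val).trans h).trans
    ((pairIso_map K'.T K'.S Fin.val).symm K'.toDrawing.nodup K'.leafSet_eq)

theorem toDrawing_equiv_of_pairIso {K : Skeleton k} {K' : Skeleton k'}
    (h : PairIso K.T K.S K'.T K'.S) : K.toDrawing ≈ K'.toDrawing :=
  (((pairIso_map K.T K.S Fin.val).symm K.toDrawing.nodup K.leafSet_eq).trans h).trans
    (pairIso_map K'.T K'.S Fin.val)

theorem matched_toDrawing (K : Skeleton k) : K.toDrawing.matched = 1 := by
  rw [← K.irreducible]
  exact ((pairIso_map K.T K.S Fin.val).matchedCount_eq K.toDrawing.nodup K.leafSet_eq).symm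

theorem exists_toDrawing_equiv {d : Drawing} (hd : d.matched = 1) (hk : d.size = k) :
    ∃ K : Skeleton k, K.toDrawing ≈ d := by
  obtain ⟨T', S', hT', hS', hp⟩ := d.exists_indexed hk
  have hTS : T'.leafSet = S'.leafSet := by ext a; simp [mem_leafSet, hT', hS']
  let K : Skeleton k := ⟨T', S', hT', hS', by rw [hp.matchedCount_eq d.nodup hTS]; exact hd⟩
  exact ⟨K, ((pairIso_map T' S' Fin.val).symm K.toDrawing.nodup hTS).trans hp⟩

/-- The skeleton with two leaves. -/
def cherry : Skeleton 2 where
  T := node (leaf 0) (leaf 1)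
  S := node (leaf 0) (leaf 1)
  leaves_T := rfl
  leaves_S := rfl
  irreducible := by simp [matchedCount, clusters]

theorem eq_cherry (K : Skeleton 2) : K = cherry := by
  have key : ∀ t : BinTree (Fin 2), t.leaves = List.finRange 2 →
      t = node (leaf 0) (leaf 1) := by
    intro t ht
    obtain ⟨a, b, rfl⟩ := exists_eq_node_leaf_leaf (t := t) (by simp [ht])
    have : [a, b] = [0, 1] := ht
    simp at this
    rw [this.1, this.2]
  obtain ⟨T, S, hT, hS, h⟩ := K
  obtain rfl := key T hT
  obtain rfl := key S hS
  rfl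

/-- The drawings `d i` are grafted on the leaves of a skeleton. -/
def graft (K : Skeleton k) (d : Fin k → Drawing) : Drawing where
  -- Tagging the labels with the index of the piece makes the pieces disjoint.
  T := K.T.bind fun i => (d i).T.map (Nat.pair i)
  S := K.S.bind fun i => (d i).S.map (Nat.pair i)
  nodup := by
    rw [leaves_bind, List.nodup_flatMap]
    refine ⟨fun i _ => ?_, ?_⟩
    · rw [leaves_map]
      exact (d i).nodup.map fun a b h => (Nat.pair_eq_pair.1 h).2
    · rw [K.leaves_T]
      refine (List.nodup_finRange k).imp fun {i j} hij x hx hy => ?_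
      simp only [leaves_map, List.mem_map] at hx hy
      obtain ⟨a, -, rfl⟩ := hx
      obtain ⟨b, -, e⟩ := hy
      exact hij (Fin.ext (Nat.pair_eq_pair.1 e).1.symm)
  leaves_eq := by
    simp only [leaves_bind, leaves_map, K.leaves_T, K.leaves_S, (d _).leaves_eq]

theorem isGraft (K : Skeleton k) (d : Fin k → Drawing) :
    IsGraft K.T K.S (fun i => (d i).T.map (Nat.pair i)) fun i => (d i).S.map (Nat.pair i) where
  nodup_T := (K.graft d).nodup
  nodup_S := (K.graft d).leaves_eq ▸ (K.graft d).nodup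
  leafSet_eq := K.leafSet_eq
  irreducible := K.irreducible
  leafSet_piece i _ := by rw [leafSet_map, leafSet_map, (d i).leafSet_eq]

theorem size_graft (K : Skeleton k) (d : Fin k → Drawing) :
    (K.graft d).size = ∑ i, (d i).size := by
  simp [Drawing.size, graft, leaves_bind, List.length_flatMap, K.leaves_T, leaves_map,
    List.sum_ofFn, ← List.ofFn_eq_map]

theorem matchedCount_piece (d : Drawing) (i : ℕ) :
    matchedCount (d.T.map (Nat.pair i)) (d.S.map (Nat.pair i)) = d.matched :=
  matchedCount_map (fun _ _ _ _ h => (Nat.pair_eq_pair.1 h).2) d.leafSet_eq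

theorem matched_graft (K : Skeleton k) (d : Fin k → Drawing) :
    (K.graft d).matched = 1 + ∑ i, (d i).matched := by
  refine ((K.isGraft d).matchedCount_bind K.leafSet_T).trans ?_
  simp only [matchedCount_piece]

theorem pairIso_piece_symm (d : Drawing) (i : ℕ) :
    PairIso (d.T.map (Nat.pair i)) (d.S.map (Nat.pair i)) d.T d.S := by
  refine (pairIso_map d.T d.S (Nat.pair i)).symm ?_ d.leafSet_eq
  rw [leaves_map]
  exact d.nodup.map fun a b h => (Nat.pair_eq_pair.1 h).2

theorem graft_equiv {K : Skeleton k} {K' : Skeleton k'} {d : Fin k → Drawing}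
    {d' : Fin k' → Drawing} {τ : Fin k → Fin k'} (hT : (K.T.map τ).Iso K'.T)
    (hS : (K.S.map τ).Iso K'.S) (h : ∀ i, d i ≈ d' (τ i)) : K.graft d ≈ K'.graft d' :=
  pairIso_bind (K.isGraft d).nodup_T K.leafSet_eq (K.isGraft d).leafSet_piece hT hS fun i _ =>
    ((pairIso_piece_symm (d i) i).trans (h i)).trans (pairIso_map _ _ _)

theorem exists_of_graft_equiv {K : Skeleton k} {K' : Skeleton k'} {d : Fin k → Drawing}
    {d' : Fin k' → Drawing} (h : K.graft d ≈ K'.graft d') :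
    ∃ τ : Fin k → Fin k', (K.T.map τ).Iso K'.T ∧ (K.S.map τ).Iso K'.S ∧
      ∀ i, d i ≈ d' (τ i) := by
  obtain ⟨φ, h1, h2⟩ := h
  have g1 := h1
  have g2 := h2
  rw [graft, graft, map_bind] at g1 g2
  -- After moving `φ` into the pieces, the isomorphism preserves labels and `IsGraft.exists_iso`
  -- applies.
  have hG : IsGraft K.T K.S (fun i => ((d i).T.map (Nat.pair i)).map φ)
      (fun i => ((d i).S.map (Nat.pair i)).map φ) :=
    ⟨g1.leaves_perm.nodup_iff.2 (K'.isGraft d').nodup_T,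
      g2.leaves_perm.nodup_iff.2 (K'.isGraft d').nodup_S, K.leafSet_eq, K.irreducible,
      fun i hi => by rw [leafSet_map, (K.isGraft d).leafSet_piece i hi, ← leafSet_map]⟩
  obtain ⟨τ, a1, a2, a3⟩ := hG.exists_iso (K'.isGraft d') g1 g2
  refine ⟨τ, a1, a2, fun i => ?_⟩
  have hi : i ∈ K.T.leafSet := by rw [K.leafSet_T]; trivial
  exact (pairIso_map _ _ (Nat.pair i)).trans
    (PairIso.trans ⟨φ, (a3 i hi).1, (a3 i hi).2⟩ (pairIso_piece_symm _ _))

theorem exists_equiv_graft {d : Drawing} (h : 2 ≤ d.size) :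
    ∃ (k : ℕ) (K : Skeleton k) (e : Fin k → Drawing), d ≈ K.graft e := by
  obtain ⟨k, T₀, S₀, f, g, hT, hS, h1, eT, eS, hfg⟩ := exists_graft d.leaves_eq d.nodup h
  have hu : T₀.leafSet = Set.univ := by ext a; simp [mem_leafSet, hT]
  have hnd : (T₀.bind f).leaves.Nodup := eT ▸ d.nodup
  let K : Skeleton k := ⟨T₀, S₀, hT, hS, h1⟩
  let e : Fin k → Drawing := fun i => ⟨f i, g i,
    (nodup_leaves_of_nodup_bind hnd).2.1 i (hu ▸ Set.mem_univ i), hfg i⟩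
  refine ⟨k, K, e, ?_⟩
  rw [Drawing.equiv_def, ← eT, ← eS]
  refine pairIso_bind (τ := fun i => i) hnd K.leafSet_eq (fun i _ => (e i).leafSet_eq) ?_ ?_
    fun i _ => pairIso_map _ _ _
  · rw [map_id']; exact Iso.rfl' _
  · rw [map_id']; exact Iso.rfl' _

theorem length_eq_of_iso {K : Skeleton k} {K' : Skeleton k'} {τ : Fin k → Fin k'}
    (hT : (K.T.map τ).Iso K'.T) : k = k' := by
  have := hT.leaves_perm.length_eq
  simpa [leaves_map, K.leaves_T, K'.leaves_T] using this

theorem injective_of_iso {K : Skeleton k} {K' : Skeleton k'} {τ : Fin k → Fin k'}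
    (hT : (K.T.map τ).Iso K'.T) : Function.Injective τ := by
  have := injOn_of_iso_map hT K'.nodup_T
  rwa [K.leafSet_T, Set.injOn_univ] at this

theorem eq_self_of_iso {K : Skeleton k} {τ : Fin k → Fin k} (hT : (K.T.map τ).Iso K.T)
    (hS : (K.S.map τ).Iso K.S) (hk : k ≠ 2) (i : Fin k) : τ i = i :=
  eq_of_automorphism hT hS K.nodup_T (by rw [K.leaves_T, K.leaves_S]) K.irreducible
    (by have := K.two_le; rw [K.leaves_T, List.length_finRange]; omega) i
    (by rw [K.leafSet_T]; trivial)

end Skeleton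

/-! ### Planar classes and the bijection with decompositions. -/

/-- Planar tanglegrams up to isomorphism. -/
def PlanarClass : Type := Quotient Drawing.setoid

namespace PlanarClass

def size (p : PlanarClass) : ℕ := Quotient.lift Drawing.size (fun _ _ => Drawing.size_congr) p

noncomputable def matched (p : PlanarClass) : ℕ :=
  Quotient.lift Drawing.matched (fun _ _ => Drawing.matched_congr) p

/-- An arbitrary order, whose only purpose is to represent an unordered pair by its sorted version.
-/
noncomputable instance : LinearOrder PlanarClass := IsWellOrder.linearOrder WellOrderingRel

noncomputable def out (p : PlanarClass) : Drawing := Quotient.out p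

def mk (d : Drawing) : PlanarClass := Quotient.mk _ d

theorem mk_eq_mk {d d' : Drawing} : mk d = mk d' ↔ d ≈ d' := Quotient.eq

theorem mk_out (p : PlanarClass) : mk p.out = p := Quotient.out_eq p

theorem exists_mk_eq (p : PlanarClass) : ∃ d, mk d = p := ⟨_, p.mk_out⟩

theorem out_mk_equiv (d : Drawing) : (mk d).out ≈ d := mk_eq_mk.1 (mk_out _)

@[simp] theorem size_mk (d : Drawing) : (mk d).size = d.size := rfl

@[simp] theorem matched_mk (d : Drawing) : (mk d).matched = d.matched := rfl

theorem size_out (p : PlanarClass) : p.out.size = p.size := by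
  conv_rhs => rw [← p.mk_out, size_mk]

theorem matched_out (p : PlanarClass) : p.out.matched = p.matched := by
  conv_rhs => rw [← p.mk_out, matched_mk]

theorem size_pos (p : PlanarClass) : 0 < p.size := p.size_out ▸ p.out.size_pos

variable {k k' : ℕ}

/-- The class obtained by grafting planar classes on the leaves of a skeleton. -/
noncomputable def graft (K : Skeleton k) (c : Fin k → PlanarClass) : PlanarClass :=
  mk (K.graft fun i => (c i).out)

theorem graft_eq_graft_iff {K : Skeleton k} {K' : Skeleton k'} {c : Fin k → PlanarClass}
    {c' : Fin k' → PlanarClass} :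
    graft K c = graft K' c' ↔ ∃ τ : Fin k → Fin k', (K.T.map τ).Iso K'.T ∧
      (K.S.map τ).Iso K'.S ∧ ∀ i, c i = c' (τ i) := by
  rw [graft, graft, mk_eq_mk]
  constructor
  · intro h
    obtain ⟨τ, h1, h2, h3⟩ := Skeleton.exists_of_graft_equiv h
    exact ⟨τ, h1, h2, fun i => by rw [← (c i).mk_out, mk_eq_mk.2 (h3 i), mk_out]⟩
  · rintro ⟨τ, h1, h2, h3⟩
    exact Skeleton.graft_equiv h1 h2 fun i => by rw [h3 i]

theorem size_graft (K : Skeleton k) (c : Fin k → PlanarClass) :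
    (graft K c).size = ∑ i, (c i).size := by
  rw [graft, size_mk, Skeleton.size_graft]
  simp only [size_out]

theorem matched_graft (K : Skeleton k) (c : Fin k → PlanarClass) :
    (graft K c).matched = 1 + ∑ i, (c i).matched := by
  rw [graft, matched_mk, Skeleton.matched_graft]
  simp only [matched_out]

theorem exists_eq_graft {p : PlanarClass} (h : 2 ≤ p.size) :
    ∃ (k : ℕ) (K : Skeleton k) (c : Fin k → PlanarClass), p = graft K c := by
  obtain ⟨d, rfl⟩ := p.exists_mk_eq
  obtain ⟨k, K, e, h⟩ := Skeleton.exists_equiv_graft h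
  refine ⟨k, K, fun i => mk (e i), mk_eq_mk.2 (h.trans ?_)⟩
  refine Skeleton.graft_equiv (τ := fun i => i) ?_ ?_ fun i =>
    Setoid.symm (out_mk_equiv (e i))
  · rw [map_id']; exact Iso.rfl' _
  · rw [map_id']; exact Iso.rfl' _

/-- The class of the tanglegram with a single leaf. -/
def unit : PlanarClass := mk ⟨leaf 0, leaf 0, by simp, rfl⟩

theorem size_unit : unit.size = 1 := rfl

theorem matched_unit : unit.matched = 0 := Drawing.matched_eq_zero rfl

theorem eq_unit {p : PlanarClass} (h : p.size = 1) : p = unit := by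
  obtain ⟨d, rfl⟩ := p.exists_mk_eq
  obtain ⟨T, S, hnd, he⟩ := d
  have h1 : T.leaves.length = 1 := h
  obtain ⟨a, rfl⟩ := exists_eq_leaf (t := T) (by omega)
  obtain ⟨b, rfl⟩ := exists_eq_leaf (t := S) (by rw [← he]; omega)
  obtain rfl : a = b := by simpa using he
  exact mk_eq_mk.2 ⟨fun _ => 0, Iso.leaf _, Iso.leaf _⟩

/-- Irreducible planar classes of size `k`, except for the one of size two. -/
def Irreducible (k : ℕ) : Type :=
  {p : PlanarClass // (p.size = k ∧ p.matched = 1) ∧ k ≠ 2}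

theorem Irreducible.exists_skeleton (p : Irreducible k) :
    ∃ K : Skeleton k, mk K.toDrawing = p.1 := by
  obtain ⟨p, ⟨h1, h2⟩, h3⟩ := p
  obtain ⟨d, rfl⟩ := p.exists_mk_eq
  obtain ⟨K, hK⟩ := Skeleton.exists_toDrawing_equiv h2 h1
  exact ⟨K, mk_eq_mk.2 hK⟩

noncomputable def Irreducible.skeleton (p : Irreducible k) : Skeleton k :=
  p.exists_skeleton.choose

theorem Irreducible.mk_skeleton (p : Irreducible k) : mk p.skeleton.toDrawing = p.1 :=
  p.exists_skeleton.choose_spec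

/-- The data that determine a planar class: nothing for size one, otherwise an irreducible class
and the classes grafted on its leaves, which are unordered if there are two of them. -/
abbrev Decomposition : Type :=
  Unit ⊕ ({a : PlanarClass × PlanarClass // a.1 ≤ a.2} ⊕
    Σ k, Irreducible k × (Fin k → PlanarClass))

noncomputable def Decomposition.compose : Decomposition → PlanarClass
  | .inl _ => unit
  | .inr (.inl a) => graft Skeleton.cherry ![a.1.1, a.1.2]
  | .inr (.inr ⟨_, p, c⟩) => graft p.skeleton c

theorem graft_ne_unit (K : Skeleton k) (c : Fin k → PlanarClass) : graft K c ≠ unit := by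
  intro h
  have := congrArg matched h
  rw [matched_graft, matched_unit] at this
  omega

theorem compose_injective : Function.Injective Decomposition.compose := by
  rintro (_ | ⟨⟨a, b⟩, hab⟩ | ⟨k, p, c⟩) (_ | ⟨⟨a', b'⟩, hab'⟩ | ⟨k', p', c'⟩) h
  · rfl
  · exact (graft_ne_unit _ _ h.symm).elim
  · exact (graft_ne_unit _ _ h.symm).elim
  · exact (graft_ne_unit _ _ h).elim
  · obtain ⟨τ, h1, -, h3⟩ := graft_eq_graft_iff.1 h
    have hτ := Skeleton.injective_of_iso h1
    have e0 := h3 0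
    have e1 := h3 1
    have hne : τ 0 ≠ τ 1 := fun e => zero_ne_one (hτ e)
    dsimp only at hab hab'
    -- An injection of two indices is the identity or the swap; for the swap, both pairs being
    -- sorted makes all the classes equal.
    rcases Fin.exists_fin_two.1 ⟨τ 0, rfl⟩ with t0 | t0 <;>
      rcases Fin.exists_fin_two.1 ⟨τ 1, rfl⟩ with t1 | t1
    · exact (hne (t0.trans t1.symm)).elim
    · rw [t0] at e0
      rw [t1] at e1
      simp only [Matrix.cons_val_zero, Matrix.cons_val_one] at e0 e1
      subst e0 e1
      rfl
    · rw [t0] at e0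
      rw [t1] at e1
      simp only [Matrix.cons_val_zero, Matrix.cons_val_one] at e0 e1
      subst e0 e1
      obtain rfl := le_antisymm hab hab'
      rfl
    · exact (hne (t0.trans t1.symm)).elim
  · obtain ⟨τ, h1, -, -⟩ := graft_eq_graft_iff.1 h
    exact (p'.2.2 (Skeleton.length_eq_of_iso h1).symm).elim
  · exact (graft_ne_unit _ _ h).elim
  · obtain ⟨τ, h1, -, -⟩ := graft_eq_graft_iff.1 h
    exact (p.2.2 (Skeleton.length_eq_of_iso h1)).elim
  · obtain ⟨τ, h1, h2, h3⟩ := graft_eq_graft_iff.1 h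
    obtain rfl := Skeleton.length_eq_of_iso h1
    obtain rfl : p = p' := Subtype.ext (by
      rw [← p.mk_skeleton, ← p'.mk_skeleton, mk_eq_mk]
      exact Skeleton.toDrawing_equiv_of_pairIso ⟨τ, h1, h2⟩)
    -- Rigidity of the skeleton forces `τ` to be the identity.
    obtain rfl : c = c' := funext fun i => by
      rw [h3 i, Skeleton.eq_self_of_iso h1 h2 p.2.2]
    rfl

theorem compose_surjective : Function.Surjective Decomposition.compose := by
  intro p
  rcases Nat.lt_or_ge p.size 2 with h | h
  · exact ⟨.inl (), (eq_unit (by have := p.size_pos; omega)).symm⟩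
  obtain ⟨k, K, c, rfl⟩ := exists_eq_graft h
  by_cases hk : k = 2
  · subst hk
    obtain rfl := K.eq_cherry
    rcases le_total (c 0) (c 1) with hc | hc
    · refine ⟨.inr (.inl ⟨(c 0, c 1), hc⟩), ?_⟩
      exact congrArg (graft Skeleton.cherry) (funext fun i => by fin_cases i <;> rfl)
    · refine ⟨.inr (.inl ⟨(c 1, c 0), hc⟩), ?_⟩
      refine graft_eq_graft_iff.2 ⟨![1, 0], ?_, ?_, fun i => by fin_cases i <;> rfl⟩
      · exact Iso.swap (Iso.leaf _) (Iso.leaf _)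
      · exact Iso.swap (Iso.leaf _) (Iso.leaf _)
  · let p : Irreducible k := ⟨mk K.toDrawing, ⟨K.size_toDrawing, K.matched_toDrawing⟩, hk⟩
    -- The chosen skeleton of the class need not be `K` itself, so the pieces are transported along
    -- an isomorphism to `K`.
    obtain ⟨τ, h1, h2⟩ := Skeleton.pairIso_of_toDrawing_equiv (mk_eq_mk.1 p.mk_skeleton)
    exact ⟨.inr (.inr ⟨k, p, fun i => c (τ i)⟩),
      graft_eq_graft_iff.2 ⟨τ, h1, h2, fun _ => rfl⟩⟩

noncomputable def decompositionEquiv : Decomposition ≃ PlanarClass :=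
  Equiv.ofBijective _ ⟨compose_injective, compose_surjective⟩

end PlanarClass

/-! ### Generating functions of sums, products, unordered pairs and tuples. -/

/-- The generating function of the weight `w`: the coefficient at `m` is the number of elements
of weight `m`. -/
noncomputable def weightGenFun {σ A : Type*} (w : A → σ →₀ ℕ) : MvPowerSeries σ ℚ :=
  fun m => (Nat.card {a // w a = m} : ℚ)

namespace weightGenFun

variable {σ A B : Type*}

theorem coeff_eq (w : A → σ →₀ ℕ) (m : σ →₀ ℕ) :
    MvPowerSeries.coeff m (weightGenFun w) = (Nat.card {a // w a = m} : ℚ) := rfl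

theorem comp_equiv (e : A ≃ B) (w : B → σ →₀ ℕ) :
    weightGenFun (fun a => w (e a)) = weightGenFun w := by
  ext m
  rw [coeff_eq, coeff_eq, Nat.card_congr
    (e.subtypeEquiv (p := fun a => w (e a) = m) (q := fun b => w b = m) fun _ => Iff.rfl)]

theorem finite_comp {w : A → σ →₀ ℕ} (hw : ∀ m, Finite {a // w a = m}) {f : B → A}
    (hf : Function.Injective f) (m : σ →₀ ℕ) : Finite {b // w (f b) = m} :=
  have := hw m
  Finite.of_injective (fun b => (⟨f b.1, b.2⟩ : {a // w a = m})) fun _ _ h =>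
    Subtype.ext (hf (congrArg Subtype.val h))

/-- Finite fibres are required here and below because `Nat.card` is zero on infinite types. -/
theorem sum_eq {w : A ⊕ B → σ →₀ ℕ} (h : ∀ m, Finite {a // w a = m}) :
    weightGenFun w = weightGenFun (fun a => w (.inl a)) + weightGenFun (fun b => w (.inr b)) := by
  ext m
  have := finite_comp h Sum.inl_injective m
  have := finite_comp h Sum.inr_injective m
  rw [map_add, coeff_eq, coeff_eq, coeff_eq, Nat.card_congr Equiv.subtypeSum, Nat.card_sum,
    Nat.cast_add]

/-- A pair of given total weight, sorted by the weights of its components. -/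
def prodFiberEquiv [DecidableEq σ] (w : A → σ →₀ ℕ) (v : B → σ →₀ ℕ) (m : σ →₀ ℕ) :
    {p : A × B // w p.1 + v p.2 = m} ≃
      Σ x : Finset.HasAntidiagonal.antidiagonal m, {a // w a = x.1.1} × {b // v b = x.1.2} where
  toFun p := ⟨⟨(w p.1.1, v p.1.2),
    Finset.HasAntidiagonal.mem_antidiagonal.2 p.2⟩, ⟨p.1.1, rfl⟩, ⟨p.1.2, rfl⟩⟩
  invFun x := ⟨(x.2.1.1, x.2.2.1), by
    rw [x.2.1.2, x.2.2.2]; exact Finset.HasAntidiagonal.mem_antidiagonal.1 x.1.2⟩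
  left_inv p := rfl
  right_inv := by
    rintro ⟨⟨⟨a, b⟩, h⟩, ⟨x, (hx : w x = a)⟩, ⟨y, (hy : v y = b)⟩⟩
    subst hx hy
    rfl

theorem finite_prod {w : A → σ →₀ ℕ} {v : B → σ →₀ ℕ} (hw : ∀ m, Finite {a // w a = m})
    (hv : ∀ m, Finite {b // v b = m}) (m : σ →₀ ℕ) :
    Finite {p : A × B // w p.1 + v p.2 = m} := by
  classical exact Finite.of_equiv _ (prodFiberEquiv w v m).symm

theorem prod_eq {w : A → σ →₀ ℕ} {v : B → σ →₀ ℕ} (hw : ∀ m, Finite {a // w a = m})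
    (hv : ∀ m, Finite {b // v b = m}) :
    weightGenFun (fun p : A × B => w p.1 + v p.2) = weightGenFun w * weightGenFun v := by
  classical
  ext m
  rw [MvPowerSeries.coeff_mul, coeff_eq, Nat.card_congr (prodFiberEquiv w v m), Nat.card_sigma,
    Nat.cast_sum, ← Finset.sum_coe_sort (Finset.HasAntidiagonal.antidiagonal m)]
  exact Finset.sum_congr rfl fun x _ => by rw [Nat.card_prod, Nat.cast_mul, coeff_eq, coeff_eq]

theorem unique_eq [Unique A] (w : A → σ →₀ ℕ) :
    weightGenFun w = MvPowerSeries.monomial (w default) 1 := by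
  classical
  ext m
  rw [coeff_eq, MvPowerSeries.coeff_monomial]
  split_ifs with h
  · have : Unique {a // w a = m} :=
      ⟨⟨⟨default, h.symm⟩⟩, fun a => Subtype.ext (Unique.eq_default _)⟩
    rw [Nat.card_unique, Nat.cast_one]
  · have : IsEmpty {a // w a = m} := ⟨fun a => h (by rw [← a.2, Unique.eq_default a.1])⟩
    rw [Nat.card_of_isEmpty, Nat.cast_zero]

theorem const_add_eq {w : A → σ →₀ ℕ} (hw : ∀ m, Finite {a // w a = m}) (e : σ →₀ ℕ) :
    weightGenFun (fun a => e + w a) = MvPowerSeries.monomial e 1 * weightGenFun w := by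
  rw [← unique_eq (A := Unit) fun _ => e, ← prod_eq (fun _ => inferInstance) hw]
  exact comp_equiv (Equiv.punitProd A).symm fun p => e + w p.2

theorem finite_tuple {w : A → σ →₀ ℕ} (hw : ∀ m, Finite {a // w a = m}) (k : ℕ) (m : σ →₀ ℕ) :
    Finite {c : Fin k → A // ∑ i, w (c i) = m} := by
  induction k generalizing m with
  | zero => infer_instance
  | succ k ih =>
    have := finite_prod hw ih m
    refine Finite.of_equiv _ ((Fin.consEquiv fun _ => A).subtypeEquiv
      (p := fun p => w p.1 + ∑ i, w (p.2 i) = m) fun p => ?_)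
    simp [Fin.consEquiv, Fin.sum_univ_succ]

theorem tuple_eq {w : A → σ →₀ ℕ} (hw : ∀ m, Finite {a // w a = m}) (k : ℕ) :
    weightGenFun (fun c : Fin k → A => ∑ i, w (c i)) = weightGenFun w ^ k := by
  induction k with
  | zero =>
    rw [unique_eq, pow_zero, Finset.univ_eq_empty, Finset.sum_empty,
      MvPowerSeries.monomial_zero_one]
  | succ k ih =>
    rw [pow_succ', ← ih, ← prod_eq hw (finite_tuple hw k),
      ← comp_equiv (Fin.consEquiv fun _ => A)]
    simp [Fin.consEquiv, Fin.sum_univ_succ]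

/-- Doubling all weights squares every variable; this counts the pairs with equal components. -/
theorem two_nsmul_eq (w : A → σ →₀ ℕ) :
    weightGenFun (fun a => w a + w a) =
      MvPowerSeries.subst (fun i => (MvPowerSeries.X i ^ 2 : MvPowerSeries σ ℚ))
        (weightGenFun w) := by
  rw [← MvPowerSeries.substAlgHom_apply (MvPowerSeries.HasSubst.X_pow two_ne_zero)]
  change _ = MvPowerSeries.expand 2 two_ne_zero _
  ext m
  by_cases hm : ∃ n, m = 2 • n
  · obtain ⟨n, rfl⟩ := hm
    rw [MvPowerSeries.coeff_expand_smul, coeff_eq, coeff_eq]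
    congr 1
    refine Nat.card_congr (Equiv.subtypeEquivRight fun a => ?_)
    simp [← two_nsmul, Finsupp.ext_iff]
  · obtain ⟨i, hi⟩ : ∃ i, ¬ 2 ∣ m i := by
      by_contra! h
      refine hm ⟨m.mapRange (· / 2) rfl, ?_⟩
      ext i
      simp [Nat.mul_div_cancel' (h i)]
    rw [MvPowerSeries.coeff_expand_of_not_dvd _ _ _ hi, coeff_eq]
    have : IsEmpty {a // w a + w a = m} := ⟨fun a => hm ⟨w a, by
      rw [two_nsmul]; exact a.2.symm⟩⟩
    rw [Nat.card_of_isEmpty, Nat.cast_zero]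

/-- Inclusion and exclusion: the pairs sorted upwards and those sorted downwards are equally many,
cover all pairs, and meet in the diagonal. -/
theorem ordered_pair_eq [LinearOrder A] {w : A → σ →₀ ℕ} (hw : ∀ m, Finite {a // w a = m}) :
    2 * weightGenFun (fun p : {p : A × A // p.1 ≤ p.2} => w p.1.1 + w p.1.2) =
      weightGenFun w ^ 2 + weightGenFun (fun a => w a + w a) := by
  rw [pow_two, ← prod_eq hw hw, ← map_ofNat (MvPowerSeries.C (σ := σ) (R := ℚ)) 2]
  ext m
  rw [MvPowerSeries.coeff_C_mul, map_add, coeff_eq, coeff_eq, coeff_eq]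
  set F : Set (A × A) := {p | w p.1 + w p.2 = m}
  have hF : F.Finite := finite_prod hw hw m
  set U : Set (A × A) := {p | p.1 ≤ p.2} ∩ F
  set V : Set (A × A) := {p | p.2 ≤ p.1} ∩ F
  have hU : U.Finite := hF.subset Set.inter_subset_right
  have hV : V.Finite := hF.subset Set.inter_subset_right
  have e1 : Nat.card {a : {p : A × A // p.1 ≤ p.2} // w a.1.1 + w a.1.2 = m} = U.ncard :=
    Nat.card_congr (Equiv.subtypeSubtypeEquivSubtypeInter _ fun p : A × A => w p.1 + w p.2 = m)
  have e2 : V.ncard = U.ncard := by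
    rw [← Set.ncard_image_of_injective U Prod.swap_injective]
    congr 1
    ext ⟨a, b⟩
    simp [U, V, F, add_comm]
  have e3 : U ∪ V = F := by
    ext ⟨a, b⟩
    simp [U, V, ← or_and_right, le_total]
  have e4 : (U ∩ V).ncard = Nat.card {a // w a + w a = m} := by
    have : U ∩ V = (fun a => (a, a)) '' {a | w a + w a = m} := by
      ext ⟨a, b⟩
      simp only [U, V, F, Set.mem_inter_iff, Set.mem_ofPred_eq, Set.mem_image, Prod.mk.injEq]
      constructor
      · rintro ⟨⟨h1, h2⟩, h3, -⟩
        obtain rfl := le_antisymm h1 h3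
        exact ⟨a, h2, rfl, rfl⟩
      · rintro ⟨c, h, rfl, rfl⟩
        exact ⟨⟨le_rfl, h⟩, le_rfl, h⟩
    rw [this, Set.ncard_image_of_injective _ fun a b h => congrArg Prod.fst h]
    rfl
  have key := Set.ncard_union_add_ncard_inter U V hU hV
  rw [e2, e3, e4] at key
  rw [e1]
  have : (F.ncard : ℚ) + Nat.card {a // w a + w a = m} = U.ncard + U.ncard := by
    exact_mod_cast key
  change 2 * (U.ncard : ℚ) = (F.ncard : ℚ) + _
  rw [this, two_mul]

/-- A tuple with an index in `J k`, of given total weight; the weight bounds the length. -/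
def sigmaFiberEquiv (J : ℕ → Type*) (w : A → σ →₀ ℕ) (m : σ →₀ ℕ) (N : ℕ)
    (hN : ∀ k (c : Fin k → A), ∑ i, w (c i) = m → k < N) :
    {x : Σ k, J k × (Fin k → A) // ∑ i, w (x.2.2 i) = m} ≃
      Σ k : Fin N, J k × {c : Fin k → A // ∑ i, w (c i) = m} where
  toFun x := ⟨⟨x.1.1, hN _ _ x.2⟩, x.1.2.1, ⟨x.1.2.2, x.2⟩⟩
  invFun y := ⟨⟨y.1, y.2.1, y.2.2.1⟩, y.2.2.2⟩
  left_inv _ := rfl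
  right_inv _ := rfl

theorem lt_of_sum_eq {w : A → σ →₀ ℕ} {s : σ} (hs : ∀ a, 0 < w a s) {m : σ →₀ ℕ} {k : ℕ}
    {c : Fin k → A} (h : ∑ i, w (c i) = m) : k < m s + 1 := by
  have : ∑ _i : Fin k, 1 ≤ ∑ i, w (c i) s := Finset.sum_le_sum fun i _ => hs (c i)
  rw [← h, Finsupp.finsetSum_apply]
  simp at this
  omega

theorem hasSubst {w : A → σ →₀ ℕ} {s : σ} (hs : ∀ a, 0 < w a s) :
    PowerSeries.HasSubst (weightGenFun w) := by
  refine PowerSeries.HasSubst.of_constantCoeff_zero ?_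
  rw [← MvPowerSeries.coeff_zero_eq_constantCoeff_apply, coeff_eq]
  have : IsEmpty {a // w a = 0} := ⟨fun a => by have := hs a.1; rw [a.2] at this; simp at this⟩
  rw [Nat.card_of_isEmpty, Nat.cast_zero]

theorem finite_sigma {J : ℕ → Type*} [∀ k, Finite (J k)] {w : A → σ →₀ ℕ}
    (hw : ∀ m, Finite {a // w a = m}) {s : σ} (hs : ∀ a, 0 < w a s) (m : σ →₀ ℕ) :
    Finite {x : Σ k, J k × (Fin k → A) // ∑ i, w (x.2.2 i) = m} := by
  have := fun k => finite_tuple hw k m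
  exact Finite.of_equiv _ (sigmaFiberEquiv J w m _ fun k c => lt_of_sum_eq hs).symm

/-- Tuples of length `k` are counted by the `k`-th power. Each entry weighs at least one in the
coordinate `s`, so only lengths up to `m s` contribute to the coefficient at `m`. -/
theorem sigma_eq {J : ℕ → Type*} [∀ k, Finite (J k)] {w : A → σ →₀ ℕ}
    (hw : ∀ m, Finite {a // w a = m}) {s : σ} (hs : ∀ a, 0 < w a s) :
    weightGenFun (fun x : Σ k, J k × (Fin k → A) => ∑ i, w (x.2.2 i)) =
      PowerSeries.subst (weightGenFun w) (PowerSeries.mk fun k => (Nat.card (J k) : ℚ)) := by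
  ext m
  have := fun k => finite_tuple hw k m
  rw [PowerSeries.coeff_subst (hasSubst hs), coeff_eq,
    Nat.card_congr (sigmaFiberEquiv J w m _ fun k c => lt_of_sum_eq hs), Nat.card_sigma,
    finsum_eq_sum_of_support_subset (s := Finset.range (m s + 1)), Nat.cast_sum,
    ← Fin.sum_univ_eq_sum_range]
  · refine Finset.sum_congr rfl fun k _ => ?_
    rw [Nat.card_prod, Nat.cast_mul, PowerSeries.coeff_mk, smul_eq_mul, ← tuple_eq hw, coeff_eq]
  · intro k hk
    rw [Finset.coe_range, Set.mem_Iio]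
    by_contra hlt
    refine hk ?_
    have : IsEmpty {c : Fin k → A // ∑ i, w (c i) = m} := ⟨fun c => hlt (lt_of_sum_eq hs c.2)⟩
    dsimp only
    rw [← tuple_eq hw, coeff_eq, Nat.card_of_isEmpty, Nat.cast_zero, smul_zero]

end weightGenFun

/-! ### Translation between tanglegrams and drawings. -/

namespace BinTree

variable {α β : Type}

theorem setOf_length_le_finite [Finite α] (n : ℕ) :
    {t : BinTree α | t.leaves.length ≤ n}.Finite := by
  induction n with
  | zero =>
    refine Set.finite_empty.subset fun t ht => ?_
    have := t.leaves_length_pos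
    simp only [Set.mem_ofPred_eq] at ht
    omega
  | succ n ih =>
    refine ((Set.finite_range leaf).union (ih.image2 node ih)).subset fun t ht => ?_
    cases t with
    | leaf a => exact Or.inl ⟨a, rfl⟩
    | node l r =>
      have h1 := l.leaves_length_pos
      have h2 := r.leaves_length_pos
      rw [Set.mem_ofPred_eq, leaves_node, List.length_append] at ht
      exact Or.inr ⟨l, by simp only [Set.mem_ofPred_eq]; omega, r,
        by simp only [Set.mem_ofPred_eq]; omega, rfl⟩

/-- Lets a planar embedding of a relabelled tree be read as one of the original tree. -/
theorem exists_map_eq_of_iso {f : α → β} {t : BinTree α} {s : BinTree β} (h : (t.map f).Iso s) :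
    ∃ t', t.Iso t' ∧ t'.map f = s := by
  induction t generalizing s with
  | leaf a =>
    cases h
    exact ⟨leaf a, Iso.leaf a, rfl⟩
  | node l r hl hr =>
    cases h with
    | node h1 h2 =>
      obtain ⟨l', il, rfl⟩ := hl h1
      obtain ⟨r', ir, rfl⟩ := hr h2
      exact ⟨node l' r', Iso.node il ir, rfl⟩
    | swap h1 h2 =>
      obtain ⟨l', il, rfl⟩ := hl h1
      obtain ⟨r', ir, rfl⟩ := hr h2
      exact ⟨node r' l', Iso.swap il ir, rfl⟩

theorem mem_clusters_iff {t : BinTree α} {A : Set α} :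
    A ∈ t.clusters ↔ ∃ u ∈ t.vertices, u.IsInternal ∧ u.leafSet = A := by
  induction t with
  | leaf a =>
    simp only [clusters, vertices, Set.mem_empty_iff_false, Set.mem_singleton_iff, false_iff]
    rintro ⟨u, rfl, ⟨l, r, h⟩, -⟩
    cases h
  | node l r hl hr =>
    simp only [clusters, vertices, Set.mem_insert_iff, Set.mem_union, hl, hr, or_and_right,
      exists_or, exists_eq_left]
    have hi : (node l r).IsInternal := ⟨l, r, rfl⟩
    rw [eq_comm (a := A), and_iff_right hi]

theorem self_mem_vertices (u : BinTree α) : u ∈ u.vertices := by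
  cases u
  · exact Set.mem_singleton _
  · exact Set.mem_insert _ _

theorem isInternal_of_mem_vertices {t u : BinTree α} (hu : u ∈ t.vertices)
    (h : u.IsInternal) : t.IsInternal := by
  cases t with
  | leaf a =>
    rw [Set.mem_singleton_iff.1 hu] at h
    exact h
  | node l r => exact ⟨l, r, rfl⟩

theorem leafSet_subset_of_mem_vertices {t u : BinTree α} (h : u ∈ t.vertices) :
    u.leafSet ⊆ t.leafSet := by
  induction t with
  | leaf a => rw [Set.mem_singleton_iff.1 h]
  | node l r hl hr =>
    rcases h with rfl | h | h
    · exact subset_rfl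
    · rw [leafSet_node]; exact (hl h).trans Set.subset_union_left
    · rw [leafSet_node]; exact (hr h).trans Set.subset_union_right

theorem not_leafSet_node_subset {l r u : BinTree α} (hd : Disjoint l.leafSet r.leafSet)
    (h : u.leafSet ⊆ l.leafSet ∨ u.leafSet ⊆ r.leafSet) : (node l r).leafSet ≠ u.leafSet := by
  intro e
  rw [← e, leafSet_node] at h
  obtain ⟨a, ha⟩ := l.leafSet_nonempty
  obtain ⟨b, hb⟩ := r.leafSet_nonempty
  rcases h with h | h
  · exact Set.disjoint_left.1 hd (h (Or.inr hb)) hb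
  · exact Set.disjoint_left.1 hd ha (h (Or.inl ha))

/-- The vertices of a tree with distinct labels are determined by their leaf sets. -/
theorem injOn_leafSet {t : BinTree α} (ht : t.leaves.Nodup) :
    Set.InjOn leafSet t.vertices := by
  induction t with
  | leaf a =>
    intro u hu v hv _
    rw [Set.mem_singleton_iff.1 hu, Set.mem_singleton_iff.1 hv]
  | node l r hl hr =>
    obtain ⟨nl, nr, hd⟩ := nodup_node ht
    have disj : ∀ u ∈ l.vertices, ∀ v ∈ r.vertices, u.leafSet ≠ v.leafSet := by
      intro u hu v hv e
      obtain ⟨x, hx⟩ := u.leafSet_nonempty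
      exact Set.disjoint_left.1 hd (leafSet_subset_of_mem_vertices hu hx)
        (leafSet_subset_of_mem_vertices hv (e ▸ hx))
    have root : ∀ u ∈ l.vertices ∪ r.vertices, (node l r).leafSet ≠ u.leafSet := fun u hu =>
      not_leafSet_node_subset hd
        (hu.imp leafSet_subset_of_mem_vertices leafSet_subset_of_mem_vertices)
    rintro u (rfl | hu) v (rfl | hv) e
    · rfl
    · exact (root v hv e).elim
    · exact (root u hu e.symm).elim
    · rcases hu with hu | hu <;> rcases hv with hv | hv
      · exact hl nl hu hv e
      · exact (disj u hu v hv e).elim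
      · exact (disj v hv u hu e.symm).elim
      · exact hr nr hu hv e

end BinTree

/-- A class is determined by a pair of trees with leaves labelled by `Fin n`, and there are finitely
many of these. -/
theorem PlanarClass.finite_size_eq (n : ℕ) : Finite {p : PlanarClass // p.size = n} := by
  choose T S hT hS h using fun p : {p : PlanarClass // p.size = n} =>
    p.1.out.exists_indexed (p.1.size_out.trans p.2)
  have hfin : Finite {t : BinTree (Fin n) // t.leaves.length ≤ n} := setOf_length_le_finite n
  refine Finite.of_injective (β := {t : BinTree (Fin n) // t.leaves.length ≤ n} ×
      {t : BinTree (Fin n) // t.leaves.length ≤ n})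
    (fun p => (⟨T p, by simp [hT]⟩, ⟨S p, by simp [hS]⟩)) fun p q hpq => ?_
  simp only [Prod.mk.injEq, Subtype.mk.injEq] at hpq
  have hp := (h p).symm p.1.out.nodup (by ext a; simp [mem_leafSet, hT, hS])
  have hq := h q
  rw [← hpq.1, ← hpq.2] at hq
  refine Subtype.ext ?_
  rw [← p.1.mk_out, ← q.1.mk_out, mk_eq_mk]
  exact hp.trans hq

namespace Tanglegram

variable {n : ℕ}

/-- The drawing `d` is a planar layout of the tanglegram `t`, up to relabelling. -/
def IsDrawnBy (t : Tanglegram n) (d : Drawing) : Prop :=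
  PairIso (t.T.map t.φ) t.S d.T d.S

theorem leafSet_S (t : Tanglegram n) : t.S.leafSet = Set.univ :=
  Set.eq_univ_of_forall t.mem_S

theorem leafSet_map_T (t : Tanglegram n) : (t.T.map t.φ).leafSet = Set.univ := by
  rw [leafSet_map, Set.eq_univ_of_forall (s := t.T.leafSet) t.mem_T, Set.image_univ,
    Equiv.range_eq_univ]

theorem leafSet_eq (t : Tanglegram n) : (t.T.map t.φ).leafSet = t.S.leafSet := by
  rw [t.leafSet_S, t.leafSet_map_T]

theorem iso_iff_pairIso {t t' : Tanglegram n} :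
    t.Iso t' ↔ PairIso (t.T.map t.φ) t.S (t'.T.map t'.φ) t'.S := by
  constructor
  · rintro ⟨σ, τ, h1, h2, h3⟩
    refine ⟨τ, ?_, h2⟩
    have := h1.map t'.φ
    rw [map_map] at this ⊢
    simpa only [h3] using this
  · rintro ⟨f, h1, h2⟩
    have hf : Function.Injective f := by
      have := injOn_of_iso_map h2 t'.nodup_S
      rwa [t.leafSet_S, Set.injOn_univ] at this
    let τ : Equiv.Perm (Fin n) := Equiv.ofBijective f (Finite.injective_iff_bijective.1 hf)
    -- Compatibility with the matchings leaves no choice for the relabelling of the first tree.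
    refine ⟨(t.φ.trans τ).trans t'.φ.symm, τ, ?_, h2, fun i => ?_⟩
    · have := h1.map t'.φ.symm
      rw [map_map, map_map, map_map] at this
      simp only [Equiv.symm_apply_apply, map_id'] at this
      exact this
    · simp

theorem IsDrawnBy.iso_iff {t t' : Tanglegram n} {d d' : Drawing} (h : t.IsDrawnBy d)
    (h' : t'.IsDrawnBy d') : t.Iso t' ↔ d ≈ d' := by
  rw [iso_iff_pairIso, Drawing.equiv_def]
  exact ⟨fun g => ((h.symm d.nodup t.leafSet_eq).trans g).trans h',
    fun g => (h.trans g).trans (h'.symm d'.nodup t'.leafSet_eq)⟩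

theorem IsDrawnBy.size_eq {t : Tanglegram n} {d : Drawing} (h : t.IsDrawnBy d) : d.size = n := by
  have h1 := h.length_eq
  have h2 : t.T.leaves.length = n := by
    rw [((List.perm_ext_iff_of_nodup t.nodup_T (List.nodup_finRange n)).2
      (by simp [t.mem_T])).length_eq, List.length_finRange]
  rw [Drawing.size, ← h1, leaves_map, List.length_map, h2]

/-- The leaf set of the second vertex determines the pair, since distinct vertices have distinct
leaf sets. -/
theorem ncard_leafMatchedPairs (t : Tanglegram n) :
    t.leafMatchedPairs.ncard = matchedCount (t.T.map t.φ) t.S := by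
  refine Set.ncard_congr (fun p _ => p.2.leafSet) ?_ ?_ ?_
  · rintro ⟨u, v⟩ ⟨h1, h2, h3, h4, h5⟩
    refine ⟨?_, mem_clusters_iff.2 ⟨v, h3, h4, rfl⟩⟩
    rw [clusters_map]
    exact ⟨u.leafSet, mem_clusters_iff.2 ⟨u, h1, h2, rfl⟩, h5⟩
  · rintro ⟨u, v⟩ ⟨u', v'⟩ ⟨h1, h2, h3, h4, h5⟩ ⟨h1', h2', h3', h4', h5'⟩ e
    dsimp only at *
    have e' : u.leafSet = u'.leafSet :=
      (Set.image_injective.2 t.φ.injective) (h5.trans (e.trans h5'.symm))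
    rw [injOn_leafSet t.nodup_T h1 h1' e', injOn_leafSet t.nodup_S h3 h3' e]
  · rintro A ⟨hA, hA'⟩
    rw [clusters_map] at hA
    obtain ⟨B, hB, rfl⟩ := hA
    obtain ⟨u, h1, h2, rfl⟩ := mem_clusters_iff.1 hB
    obtain ⟨v, h3, h4, h5⟩ := mem_clusters_iff.1 hA'
    exact ⟨(u, v), ⟨h1, h2, h3, h4, h5.symm⟩, h5⟩

theorem IsDrawnBy.ncard_eq {t : Tanglegram n} {d : Drawing} (h : t.IsDrawnBy d) :
    t.leafMatchedPairs.ncard = d.matched := by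
  rw [ncard_leafMatchedPairs]
  exact PairIso.matchedCount_eq h d.nodup t.leafSet_eq

/-- Any leaf-matched pair shows that both roots are internal, so the roots themselves are a
leaf-matched pair. -/
theorem isIrreducible_iff (t : Tanglegram n) :
    t.IsIrreducible ↔ t.leafMatchedPairs.ncard = 1 := by
  refine ⟨fun h => by rw [h, Set.ncard_singleton], fun h => ?_⟩
  obtain ⟨p, hp⟩ := Set.ncard_eq_one.1 h
  have hmem : p ∈ t.leafMatchedPairs := hp ▸ rfl
  have hroot : (t.T, t.S) ∈ t.leafMatchedPairs := by
    refine ⟨self_mem_vertices _, isInternal_of_mem_vertices hmem.1 hmem.2.1, self_mem_vertices _,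
      isInternal_of_mem_vertices hmem.2.2.1 hmem.2.2.2.1, ?_⟩
    rw [← leafSet_map, leafSet_eq]
  rw [IsIrreducible, hp]
  rw [hp, Set.mem_singleton_iff] at hroot
  rw [hroot]

/-- Without crossings, `X.map t.φ` is a rearrangement of `Y` sorted by position in `Y`, hence equal
to `Y`. -/
theorem crossings_eq_zero_iff {t : Tanglegram n} {X Y : List (Fin n)} (hX : X.Nodup)
    (hY : Y.Nodup) (hX' : ∀ i, i ∈ X) (hY' : ∀ i, i ∈ Y) :
    t.crossings X Y = 0 ↔ X.map t.φ = Y := by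
  rw [crossings, Finset.card_eq_zero, Finset.filter_eq_empty_iff]
  constructor
  · intro h
    have hperm : (X.map t.φ).Perm Y := (List.perm_ext_iff_of_nodup (hX.map t.φ.injective) hY).2
      fun a => ⟨fun _ => hY' a, fun _ => List.mem_map.2 ⟨t.φ.symm a, hX' _, by simp⟩⟩
    refine hperm.eq_of_pairwise (le := fun a b => Y.idxOf a ≤ Y.idxOf b)
      (fun a b ha hb h1 h2 => (List.idxOf_inj (hY' a)).1 (le_antisymm h1 h2)) ?_ ?_
    · rw [List.pairwise_map, List.pairwise_iff_getElem]
      intro i j hi hj hij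
      have := @h (X[i], X[j]) (Finset.mem_univ _)
      simpa [hX.idxOf_getElem, hij] using this
    · rw [List.pairwise_iff_getElem]
      intro i j hi hj hij
      simpa [hY.idxOf_getElem] using hij.le
  · rintro rfl ⟨i, j⟩ - ⟨h1, h2⟩
    dsimp only at h1 h2
    have key : ∀ i, (X.map t.φ).idxOf (t.φ i) = X.idxOf i := by
      intro i
      have hlt := List.idxOf_lt_length_of_mem (hX' i)
      have := hY.idxOf_getElem (X.idxOf i) (by simpa using hlt)
      simpa using this
    simp only [key] at h2
    omega

theorem isPlanar_iff (t : Tanglegram n) :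
    t.IsPlanar ↔ ∃ T' S', t.T.Iso T' ∧ t.S.Iso S' ∧ T'.leaves.map t.φ = S'.leaves := by
  have key : ∀ {T' S'}, t.T.Iso T' → t.S.Iso S' →
      (t.crossings T'.leaves S'.leaves = 0 ↔ T'.leaves.map t.φ = S'.leaves) := fun hT hS =>
    crossings_eq_zero_iff (hT.leaves_perm.nodup_iff.1 t.nodup_T)
      (hS.leaves_perm.nodup_iff.1 t.nodup_S) (fun i => hT.leaves_perm.mem_iff.1 (t.mem_T i))
      fun i => hS.leaves_perm.mem_iff.1 (t.mem_S i)
  rw [IsPlanar, crossingNumber, Nat.sInf_eq_zero]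
  constructor
  · rintro (⟨_, _, ⟨⟨T', hT, rfl⟩, S', hS, rfl⟩, h⟩ | h)
    -- The infimum of an empty set would also be zero; the next case excludes this with the layout
    -- given by the trees themselves.
    · exact ⟨T', S', hT, hS, (key hT hS).1 h⟩
    · exact (Set.eq_empty_iff_forall_notMem.1 h _ ⟨_, _, ⟨⟨t.T, BinTree.Iso.rfl' _, rfl⟩,
        t.S, BinTree.Iso.rfl' _, rfl⟩, rfl⟩).elim
  · rintro ⟨T', S', hT, hS, h⟩
    exact Or.inl ⟨_, _, ⟨⟨T', hT, rfl⟩, S', hS, rfl⟩, (key hT hS).2 h⟩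

theorem IsPlanar.exists_isDrawnBy {t : Tanglegram n} (h : t.IsPlanar) :
    ∃ d, t.IsDrawnBy d := by
  obtain ⟨T', S', hT, hS, h⟩ := t.isPlanar_iff.1 h
  have hnd := hT.leaves_perm.nodup_iff.1 t.nodup_T
  refine ⟨⟨(T'.map t.φ).map Fin.val, S'.map Fin.val, ?_, ?_⟩, Fin.val, (hT.map _).map _,
    hS.map _⟩
  · rw [leaves_map, leaves_map]
    exact (hnd.map t.φ.injective).map Fin.val_injective
  · rw [leaves_map, leaves_map, leaves_map, h]

theorem IsDrawnBy.isPlanar {t : Tanglegram n} {d : Drawing} (h : t.IsDrawnBy d) :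
    t.IsPlanar := by
  obtain ⟨f, h1, h2⟩ := h
  have hf : Function.Injective f := by
    have := injOn_of_iso_map h2 (d.leaves_eq ▸ d.nodup)
    rwa [t.leafSet_S, Set.injOn_univ] at this
  rw [map_map] at h1
  obtain ⟨T', hT, eT⟩ := exists_map_eq_of_iso h1
  obtain ⟨S', hS, eS⟩ := exists_map_eq_of_iso h2
  refine t.isPlanar_iff.2 ⟨T', S', hT, hS, List.map_injective_iff.2 hf ?_⟩
  have := d.leaves_eq
  rw [← eT, ← eS, leaves_map, leaves_map] at this
  rw [← this, List.map_map]
  rfl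

theorem exists_isDrawnBy {d : Drawing} (hd : d.size = n) : ∃ t : Tanglegram n, t.IsDrawnBy d := by
  obtain ⟨T, S, hT, hS, h⟩ := d.exists_indexed hd
  refine ⟨⟨T, S, Equiv.refl _, by rw [hT]; exact List.nodup_finRange n, by simp [hT],
    by rw [hS]; exact List.nodup_finRange n, by simp [hS]⟩, ?_⟩
  have e : T.map (Equiv.refl (Fin n)) = T := BinTree.map_id' T
  rw [IsDrawnBy, e]
  exact h

/-- The number of planar tanglegrams with a given number of leaf-matched pairs. -/
theorem count_planar (n k : ℕ) :
    count n (fun t => t.IsPlanar ∧ t.leafMatchedPairs.ncard = k) =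
      Nat.card {p : PlanarClass // p.size = n ∧ p.matched = k} := by
  choose t ht using fun (p : PlanarClass) (hp : p.size = n ∧ p.matched = k) =>
    exists_isDrawnBy (p.size_out.trans hp.1)
  symm
  refine Set.ncard_congr (s := {p : PlanarClass | p.size = n ∧ p.matched = k})
    (fun p hp => Quotient.mk (isoSetoid n) (t p hp)) ?_ ?_ ?_
  · intro p hp
    exact ⟨t p hp, ⟨(ht p hp).isPlanar, by
      rw [(ht p hp).ncard_eq, p.matched_out, hp.2]⟩, rfl⟩
  · intro p q hp hq e
    have := ((ht p hp).iso_iff (ht q hq)).1 (Quotient.exact e)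
    rw [← p.mk_out, ← q.mk_out, PlanarClass.mk_eq_mk]
    exact this
  · rintro _ ⟨s, ⟨hs, hs'⟩, rfl⟩
    obtain ⟨d, hd⟩ := hs.exists_isDrawnBy
    have hp : (PlanarClass.mk d).size = n ∧ (PlanarClass.mk d).matched = k :=
      ⟨hd.size_eq, by rw [PlanarClass.matched_mk, ← hd.ncard_eq, hs']⟩
    exact ⟨PlanarClass.mk d, hp,
      Quotient.sound (((ht _ hp).iso_iff hd).2 (PlanarClass.out_mk_equiv d))⟩

end Tanglegram

/-! ### The functional equation. -/

namespace PlanarClass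

/-- The size and the number of leaf-matched pairs, as an exponent of the monomials `x ^ m q ^ k`. -/
noncomputable def weight (p : PlanarClass) : Fin 2 →₀ ℕ :=
  Finsupp.single 0 p.size + Finsupp.single 1 p.matched

theorem weight_zero (p : PlanarClass) : p.weight 0 = p.size := by simp [weight]

theorem weight_one (p : PlanarClass) : p.weight 1 = p.matched := by simp [weight]

theorem weight_eq_iff {p : PlanarClass} {m : Fin 2 →₀ ℕ} :
    p.weight = m ↔ p.size = m 0 ∧ p.matched = m 1 := by
  rw [Finsupp.ext_iff, Fin.forall_fin_two, weight_zero, weight_one]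

theorem finite_weight_eq (m : Fin 2 →₀ ℕ) : Finite {p : PlanarClass // p.weight = m} :=
  have := finite_size_eq (m 0)
  Finite.of_injective
    (fun p => (⟨p.1, (weight_eq_iff.1 p.2).1⟩ : {p : PlanarClass // p.size = m 0})) fun _ _ h =>
    Subtype.ext (Subtype.mk.inj h)

theorem weight_zero_pos (p : PlanarClass) : 0 < p.weight 0 := p.weight_zero ▸ p.size_pos

instance (k : ℕ) : Finite (Irreducible k) :=
  have := finite_size_eq k
  Finite.of_injective
    (fun p => (⟨p.1, p.2.1.1⟩ : {p : PlanarClass // p.size = k})) fun _ _ h =>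
    Subtype.ext (Subtype.mk.inj h)

theorem weight_unit : unit.weight = Finsupp.single 0 1 := by
  rw [weight, size_unit, matched_unit, Finsupp.single_zero, add_zero]

theorem weight_graft {k : ℕ} (K : Skeleton k) (c : Fin k → PlanarClass) :
    (graft K c).weight = Finsupp.single 1 1 + ∑ i, (c i).weight := by
  rw [weight_eq_iff, size_graft, matched_graft]
  simp [weight_zero, weight_one]

/-- The three kinds of decomposition give the three terms; the factor `X 1` records the pair of
roots. -/
theorem weightGenFun_weight :
    weightGenFun weight = MvPowerSeries.X 0 + (MvPowerSeries.X 1 *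
        weightGenFun (fun a : {a : PlanarClass × PlanarClass // a.1 ≤ a.2} =>
          a.1.1.weight + a.1.2.weight) +
      MvPowerSeries.X 1 * PowerSeries.subst (weightGenFun weight)
        (PowerSeries.mk fun k => (Nat.card (Irreducible k) : ℚ))) := by
  have hfin := weightGenFun.finite_comp finite_weight_eq decompositionEquiv.injective
  conv_lhs => rw [← weightGenFun.comp_equiv decompositionEquiv]
  rw [weightGenFun.sum_eq hfin, weightGenFun.unique_eq,
    weightGenFun.sum_eq (weightGenFun.finite_comp hfin Sum.inr_injective),
    ← weightGenFun.sigma_eq finite_weight_eq weight_zero_pos, MvPowerSeries.X, MvPowerSeries.X,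
    ← weightGenFun.const_add_eq (weightGenFun.finite_comp
      (weightGenFun.finite_prod finite_weight_eq finite_weight_eq) Subtype.val_injective),
    ← weightGenFun.const_add_eq (weightGenFun.finite_sigma finite_weight_eq weight_zero_pos)]
  congr 1
  · rw [← weight_unit]; rfl
  · congr 2
    · funext a
      exact (weight_graft _ _).trans (by rw [Fin.sum_univ_two]; rfl)
    · funext x
      exact weight_graft _ _

end PlanarClass

namespace Tanglegram

theorem F_eq_weightGenFun : F = weightGenFun PlanarClass.weight := by
  ext m
  rw [weightGenFun.coeff_eq]
  refine congrArg (Nat.cast (R := ℚ)) ((count_planar (m 0) (m 1)).trans ?_)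
  exact Nat.card_congr (Equiv.subtypeEquivRight fun p => PlanarClass.weight_eq_iff.symm)

/-- `Irreducible 2` is empty by definition, so the conventional coefficient is split off as a
separate term. -/
theorem H_eq : H = PowerSeries.mk (fun k => (Nat.card (PlanarClass.Irreducible k) : ℚ)) +
    (1 / 2 : ℚ) • PowerSeries.X ^ 2 := by
  ext k
  rw [H, map_add, PowerSeries.coeff_mk, PowerSeries.coeff_mk, PowerSeries.coeff_smul,
    PowerSeries.coeff_X_pow]
  split_ifs with hk
  · have : IsEmpty (PlanarClass.Irreducible k) := ⟨fun p => p.2.2 hk⟩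
    rw [Nat.card_of_isEmpty]
    norm_num
  · rw [smul_zero, add_zero]
    simp only [isIrreducible_iff, count_planar]
    exact congrArg Nat.cast (Nat.card_congr (Equiv.subtypeEquivRight fun p =>
      (and_iff_left hk).symm))

end Tanglegram

/-- With `F = F(x,q)`, `x = X 0`, `q = X 1`: the series `F(x,q)` may be substituted into `H`, the
pair `(x^2, q^2)` may be substituted into `F`, and
`F(x,q) = x + q * H(F(x,q)) + q * F(x^2,q^2) / 2`. -/
theorem theorem1p2 :
    PowerSeries.HasSubst Tanglegram.F ∧
    MvPowerSeries.HasSubst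
      (fun i : Fin 2 => (MvPowerSeries.X i ^ 2 : MvPowerSeries (Fin 2) ℚ)) ∧
    Tanglegram.F =
      MvPowerSeries.X 0
      + MvPowerSeries.X 1 * PowerSeries.subst Tanglegram.F Tanglegram.H
      + MvPowerSeries.C (1 / 2 : ℚ) * (MvPowerSeries.X 1 *
          MvPowerSeries.subst
            (fun i : Fin 2 => (MvPowerSeries.X i ^ 2 : MvPowerSeries (Fin 2) ℚ))
            Tanglegram.F) := by
  have hF : PowerSeries.HasSubst Tanglegram.F := by
    rw [Tanglegram.F_eq_weightGenFun]
    exact weightGenFun.hasSubst PlanarClass.weight_zero_pos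
  refine ⟨hF, MvPowerSeries.HasSubst.X_pow two_ne_zero, ?_⟩
  rw [Tanglegram.H_eq, PowerSeries.subst_add hF, PowerSeries.subst_smul hF,
    PowerSeries.subst_pow hF, PowerSeries.subst_X hF, Tanglegram.F_eq_weightGenFun,
    ← weightGenFun.two_nsmul_eq, MvPowerSeries.smul_eq_C_mul]
  have h2 := weightGenFun.ordered_pair_eq PlanarClass.finite_weight_eq
  have hC : (MvPowerSeries.C (1 / 2 : ℚ) : MvPowerSeries (Fin 2) ℚ) * 2 = 1 := by
    rw [← map_ofNat (MvPowerSeries.C (σ := Fin 2) (R := ℚ)) 2, ← map_mul]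
    norm_num
  conv_lhs => rw [PlanarClass.weightGenFun_weight]
  -- Half of `h2` gives the series of unordered pairs; its square term matches the contribution of
  -- `X ^ 2 / 2` in `H`.
  linear_combination (MvPowerSeries.X 1 * MvPowerSeries.C (1 / 2 : ℚ)) * h2 -
    MvPowerSeries.X 1 * weightGenFun (fun a : {a : PlanarClass × PlanarClass // a.1 ≤ a.2} =>
          a.1.1.weight + a.1.2.weight) * hC
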